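/- Let $l\ge 2$ and $\rho\ge 1$ be integers, write $[m]=\{1,\dots,m\}$, and let $L_{rel}$ be the first-order language (with equality) whose vocabulary consists of relation symbols $R_1,\dots,R_\rho$, where $R_k$ has arity $r_k$ and $2\le r_k\le l$ for every $k\in[\rho]$. A strong $l$-colouring of an $L_{rel}$-structure $\mathcal M$ with universe $M$ is a function $\gamma:M\to[l]$ such that, for every $k\in[\rho]$ and every $(a_1,\dots,a_{r_k})\in R_k^{\mathcal M}$, $\gamma(a_i)\ne\gamma(a_j)$ whenever $i\ne j$. The structure $\mathcal M$ is strongly $l$-colourable if it has a strong $l$-colouring. It is uniquely strongly $l$-colourable if, moreover, for all strong $l$-colourings $\gamma,\gamma'$ of $\mathcal M$ and all $a,b\in M$, $\gamma(a)=\gamma(b)$ if and only if $\gamma'(a)=\gamma'(b)$. Let $I\subseteq[\rho]$. For $n\ge 1$ let $\mathbf S^I_n$ be the set of strongly $l$-colourable $L_{rel}$-structures $\mathcal M$ with universe $[n]$ such that for every $k\in I$ the relation $R_k^{\mathcal M}$ is irreflexive (the entries of every tuple in it are pairwise distinct) and symmetric (it is closed under all permutations of the positions), and let $\mathbf S^I=\bigcup_{n\ge1}\mathbf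 S^I_n$. Say that almost all $\mathcal M\in\mathbf S^I$ have a property if the proportion of $\mathcal M\in\mathbf S^I_n$ having it tends to $1$ as $n\to\infty$. Then: (i) There is an $L_{rel}$-formula $\xi(x,y)$ without parameters such that for almost all $\mathcal M\in\mathbf S^I$ the following holds: for every strong $l$-colouring $\gamma:M\to[l]$ of $\mathcal M$ and all $a,b\in M$, $\gamma(a)=\gamma(b)$ if and only if $\mathcal M\models\xi(a,b)$. (ii) Almost all $\mathcal M\in\mathbf S^I$ are uniquely strongly $l$-colourable. (iii) $\mathbf S^I$ has a zero-one law: for every $L_{rel}$-sentence $\varphi$, either $\varphi$ is true in almost all $\mathcal M\in\mathbf S^I$ or $\neg\varphi$ is true in almost all $\mathcal M\in\mathbf S^I$. -/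

import Mathlib

open Filter Topology

/-- The relational vocabulary `{R_1, …, R_ρ}` in which `R_k` has arity `r k`
(and there are no function or constant symbols). -/
def relLanguage {ρ : ℕ} (r : Fin ρ → ℕ) : FirstOrder.Language.{0, 0} where
  Functions := fun _ => Empty
  Relations := fun m => {k : Fin ρ // r k = m}

/-- The symbol `R_k`. -/
def relSymbol {ρ : ℕ} (r : Fin ρ → ℕ) (k : Fin ρ) : (relLanguage r).Relations (r k) :=
  ⟨k, rfl⟩

/-- `a ∈ R_k^M`. -/
def RelHolds {ρ : ℕ} {r : Fin ρ → ℕ} {A : Type} (M : (relLanguage r).Structure A)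
    (k : Fin ρ) (a : Fin (r k) → A) : Prop :=
  M.RelMap (relSymbol r k) a

/-- A tuple is strongly multichromatic for `γ` if entries at distinct positions have
distinct colours. -/
def StronglyMultichromatic {A : Type} {l m : ℕ} (γ : A → Fin l) (a : Fin m → A) : Prop :=
  ∀ i j : Fin m, i ≠ j → γ (a i) ≠ γ (a j)

/-- `γ` is a strong `l`-colouring of `M`. -/
def IsStrongColouring {ρ : ℕ} {r : Fin ρ → ℕ} {A : Type} {l : ℕ}
    (M : (relLanguage r).Structure A) (γ : A → Fin l) : Prop :=
  ∀ (k : Fin ρ) (a : Fin (r k) → A), RelHolds M k a → StronglyMultichromatic γ a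

/-- `M` is strongly `l`-colourable. -/
def StronglyColourable {ρ : ℕ} {r : Fin ρ → ℕ} {A : Type} (l : ℕ)
    (M : (relLanguage r).Structure A) : Prop :=
  ∃ γ : A → Fin l, IsStrongColouring M γ

/-- `M` is uniquely strongly `l`-colourable: it has a strong `l`-colouring, and all of them
induce the same partition of the universe. -/
def UniquelyStronglyColourable {ρ : ℕ} {r : Fin ρ → ℕ} {A : Type} (l : ℕ)
    (M : (relLanguage r).Structure A) : Prop :=
  StronglyColourable l M ∧
    ∀ γ γ' : A → Fin l, IsStrongColouring M γ → IsStrongColouring M γ' →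
      ∀ a b : A, γ a = γ b ↔ γ' a = γ' b

/-- `R_k` is interpreted in `M` as an irreflexive relation: the entries of every tuple in it
are pairwise distinct. -/
def IrreflexiveAt {ρ : ℕ} {r : Fin ρ → ℕ} {A : Type} (M : (relLanguage r).Structure A)
    (k : Fin ρ) : Prop :=
  ∀ a : Fin (r k) → A, RelHolds M k a → ∀ i j : Fin (r k), i ≠ j → a i ≠ a j

/-- `R_k` is interpreted in `M` as a symmetric relation: it is closed under all permutations
of the positions. -/
def SymmetricAt {ρ : ℕ} {r : Fin ρ → ℕ} {A : Type} (M : (relLanguage r).Structure A)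
    (k : Fin ρ) : Prop :=
  ∀ a : Fin (r k) → A, RelHolds M k a →
    ∀ π : Equiv.Perm (Fin (r k)), RelHolds M k (fun i => a (π i))

/-- The set `S^I_n` of strongly `l`-colourable structures with the `n`-element universe `Fin n`
in which `R_k` is irreflexive and symmetric for every `k ∈ I`. -/
def strongClass {ρ : ℕ} (r : Fin ρ → ℕ) (l : ℕ) (I : Set (Fin ρ)) (n : ℕ) :
    Set ((relLanguage r).Structure (Fin n)) :=
  {M | StronglyColourable l M ∧ ∀ k ∈ I, IrreflexiveAt M k ∧ SymmetricAt M k}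

/-- There are only finitely many structures on `Fin n`, so the cardinalities below are the
true ones. -/
theorem finite_structure {ρ : ℕ} (r : Fin ρ → ℕ) (n : ℕ) :
    Finite ((relLanguage r).Structure (Fin n)) := by
  refine Finite.of_injective
    (β := (k : Fin ρ) → (Fin (r k) → Fin n) → Prop) (fun M k a => RelHolds M k a) ?_
  intro M N h
  refine FirstOrder.Language.Structure.ext ?_ ?_
  · funext m f
    exact f.elim
  · funext m R a
    obtain ⟨k, rfl⟩ := R
    exact congrFun (congrFun h k) a

/-- Almost all members of `⋃ K n` have the property `P`: the proportion of members of `K n`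
with property `P` (uniform probability measure on `K n`) tends to `1` as `n → ∞`. -/
def AlmostAll {L : FirstOrder.Language.{0, 0}} (K : (n : ℕ) → Set (L.Structure (Fin n)))
    (P : (n : ℕ) → L.Structure (Fin n) → Prop) : Prop :=
  Tendsto (fun n : ℕ => ({M | M ∈ K n ∧ P n M}.ncard : ℝ) / ((K n).ncard : ℝ)) atTop (𝓝 1)

/-- The sentence `φ` is true in `M`. -/
def SentenceTrue {L : FirstOrder.Language.{0, 0}} {A : Type} (M : L.Structure A)
    (φ : L.Sentence) : Prop :=
  @FirstOrder.Language.Sentence.Realize L A M φ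

/-- The formula `ξ(x, y)` is true in `M` at `(a, b)`; its free variables are among `x, y`. -/
def FormulaTrue {L : FirstOrder.Language.{0, 0}} {A : Type} (M : L.Structure A)
    (ξ : L.Formula (Fin 2)) (a b : A) : Prop :=
  @FirstOrder.Language.Formula.Realize L A M (Fin 2) ξ ![a, b]

/-- Zero-one law for the uniform probability measures: for each sentence, it or its negation
is true in almost all members. -/
def HasZeroOneLaw {L : FirstOrder.Language.{0, 0}}
    (K : (n : ℕ) → Set (L.Structure (Fin n))) : Prop :=
  ∀ φ : L.Sentence,
    AlmostAll K (fun _ M => SentenceTrue M φ) ∨ AlmostAll K (fun _ M => SentenceTrue M φ.not)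

/-!
A structure of the class, together with one of its strong colourings `γ`, is a free choice, for
every relation, of which tuples with distinct colours (or of which sets of entries, for the
relations that have to be symmetric) it contains. The proof compares structures with such pairs.

*Coloured extension properties.* If every colour class of `γ` is large, then in almost every
structure coloured by `γ` every one-point extension of a bounded coloured substructure that is
compatible with `γ` is realized: each candidate vertex realizes it for a proportion of the
structures that is bounded below, whatever the other candidates do
(`ncard_avoiding_le`, `exists_extensionProperties_bound`).

*Definability and uniqueness.* Given the extension properties, two vertices of the same colour can
be completed to a "rainbow" of all colours by the same `l - 1` further vertices, with all the
relations `R_1` that the colours allow. Conversely, such a completion forces the two vertices to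
have equal colours in every strong colouring. This gives the formula `sameColour`, and
`colour_eq_iff` shows that it defines the partition of every strong colouring. In particular
all strong colourings factor through one of them, so there are at most `l ^ l`.

*Unbalanced colourings.* The number of tuples with distinct colours is a multiple of an elementary
symmetric polynomial in the sizes of the colour classes. On the simplex this polynomial has its
maximum at the centre only, since levelling two coordinates increases it
(`eq_of_isMaxOn_elemSymm`), so by compactness a colouring with a small class loses a constant times
`n ^ 2` free choices against an equitable one. As there are only `l ^ n` colourings, the structures
with an unbalanced colouring are negligible (`exists_unbalanced_bound`).

*From pairs to structures.* Most pairs with a balanced colouring have the extension properties,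
and a structure occurs in at most `l ^ l` such pairs. So the number of balanced pairs is at most
a bounded multiple of the number of structures, and the few bad pairs spoil only a vanishing
proportion of the structures (`almostAll_extensionProperties`).

*Zero-one law.* Two coloured structures with extension properties for sufficiently many points
satisfy the same sentences of given complexity, by a back-and-forth argument along the formula
(`exists_realize_iff`).
-/

namespace StrongColouring

variable {ρ : ℕ} {r : Fin ρ → ℕ} {l : ℕ} {I : Set (Fin ρ)} {A B : Type}

/-! ### Coloured structures and the extension property -/

/-- The structures on `A` for which the fixed map `γ` is a strong colouring and in which `R_k` is
symmetric for every `k ∈ I`. Irreflexivity is not demanded: it follows from the colouring. -/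
def colouredClass (r : Fin ρ → ℕ) (I : Set (Fin ρ)) (γ : A → Fin l) :
    Set ((relLanguage r).Structure A) :=
  {M | IsStrongColouring M γ ∧ ∀ k ∈ I, SymmetricAt M k}

/-- The structure with prescribed relations. -/
@[reducible]
def ofRel (R : (k : Fin ρ) → (Fin (r k) → A) → Prop) : (relLanguage r).Structure A where
  funMap := fun f => f.elim
  RelMap := fun s a => R s.1 (fun i => a (Fin.cast s.2 i))

theorem relHolds_ofRel (R : (k : Fin ρ) → (Fin (r k) → A) → Prop) (k : Fin ρ)
    (a : Fin (r k) → A) : RelHolds (ofRel R) k a ↔ R k a := Iff.rfl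

theorem structure_ext {M N : (relLanguage r).Structure A}
    (h : ∀ k a, RelHolds M k a ↔ RelHolds N k a) : M = N := by
  refine FirstOrder.Language.Structure.ext ?_ ?_
  · funext m f
    exact f.elim
  · funext m R a
    obtain ⟨k, rfl⟩ := R
    exact propext (h k a)

/-- The structure on `B` induced along a map `B → A`. -/
@[reducible]
def pullback (M : (relLanguage r).Structure A) (f : B → A) : (relLanguage r).Structure B :=
  ofRel fun k t => RelHolds M k (f ∘ t)

theorem pullback_mem {M : (relLanguage r).Structure A} {γ : A → Fin l}
    (hM : M ∈ colouredClass r I γ) (f : B → A) {δ : B → Fin l} (hδ : ∀ b, γ (f b) = δ b) :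
    pullback M f ∈ colouredClass r I δ := by
  refine ⟨fun k a ha i j hij => ?_, fun k hk a ha π => hM.2 k hk _ ha π⟩
  rw [← hδ, ← hδ]
  exact hM.1 k _ ha i j hij

theorem injective_of_multichromatic {γ : A → Fin l} {m : ℕ} {a : Fin m → A}
    (h : StronglyMultichromatic γ a) : Function.Injective a := by
  intro i j hij
  by_contra hne
  exact h i j hne (congrArg γ hij)

theorem mem_strongClass_iff {n : ℕ} {M : (relLanguage r).Structure (Fin n)} :
    M ∈ strongClass r l I n ↔ ∃ γ : Fin n → Fin l, M ∈ colouredClass r I γ := by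
  constructor
  · rintro ⟨⟨γ, hγ⟩, h⟩
    exact ⟨γ, hγ, fun k hk => (h k hk).2⟩
  · rintro ⟨γ, hγ, h⟩
    refine ⟨⟨γ, hγ⟩, fun k hk => ⟨fun a ha i j hij hEq => ?_, h k hk⟩⟩
    exact hγ k a ha i j hij (congrArg γ hEq)

/-- The vertex `y` extends the tuple `e` as the last point of `T` prescribes: every relation on
tuples from `e, y` in which `y` occurs holds exactly when it holds in `T`. -/
def Realizes {m : ℕ} (M : (relLanguage r).Structure A) (e : Fin m → A)
    (T : (relLanguage r).Structure (Fin (m + 1))) (y : A) : Prop :=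
  ∀ (k : Fin ρ) (t : Fin (r k) → Fin (m + 1)), (∃ i, t i = Fin.last m) →
    (RelHolds M k ((Fin.snoc e y : Fin (m + 1) → A) ∘ t) ↔ RelHolds T k t)

/-- The extension property for `m` points: every one-point extension of an `m`-element coloured
substructure that the colours and the symmetry requirements allow is realized. -/
def ExtensionProperty (I : Set (Fin ρ)) (M : (relLanguage r).Structure A) (γ : A → Fin l)
    (m : ℕ) : Prop :=
  ∀ e : Fin m → A, Function.Injective e → ∀ (c : Fin l),
    ∀ T ∈ colouredClass r I (Fin.snoc (γ ∘ e) c : Fin (m + 1) → Fin l),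
      ∃ y, y ∉ Set.range e ∧ γ y = c ∧ Realizes M e T y

/-! ### Elementary equivalence of structures with extension properties -/

/-- Two enumerated coloured finite substructures are isomorphic through the enumerations. -/
structure Matched (M : (relLanguage r).Structure A) (N : (relLanguage r).Structure B)
    (γ : A → Fin l) (δ : B → Fin l) {m : ℕ} (e : Fin m → A) (f : Fin m → B) : Prop where
  inj_left : Function.Injective e
  inj_right : Function.Injective f
  colour : ∀ i, γ (e i) = δ (f i)
  rel : ∀ k (t : Fin (r k) → Fin m), RelHolds M k (e ∘ t) ↔ RelHolds N k (f ∘ t)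

theorem Matched.symm {M : (relLanguage r).Structure A} {N : (relLanguage r).Structure B}
    {γ : A → Fin l} {δ : B → Fin l} {m : ℕ} {e : Fin m → A} {f : Fin m → B}
    (h : Matched M N γ δ e f) : Matched N M δ γ f e :=
  ⟨h.inj_right, h.inj_left, fun i => (h.colour i).symm, fun k t => (h.rel k t).symm⟩

theorem snoc_injective {m : ℕ} {e : Fin m → A} (he : Function.Injective e) {y : A}
    (hy : y ∉ Set.range e) : Function.Injective (Fin.snoc e y : Fin (m + 1) → A) := by
  intro i j
  refine Fin.lastCases ?_ (fun i => ?_) i <;> refine Fin.lastCases ?_ (fun j => ?_) j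
  · simp
  · intro h
    simp only [Fin.snoc_last, Fin.snoc_castSucc] at h
    exact absurd ⟨j, h.symm⟩ hy
  · intro h
    simp only [Fin.snoc_last, Fin.snoc_castSucc] at h
    exact absurd ⟨i, h⟩ hy
  · intro h
    simp only [Fin.snoc_castSucc] at h
    rw [he h]

theorem exists_castSucc_comp {m p : ℕ} {t : Fin p → Fin (m + 1)}
    (h : ¬ ∃ i, t i = Fin.last m) : ∃ s : Fin p → Fin m, t = Fin.castSucc ∘ s := by
  push Not at h
  exact ⟨fun i => (t i).castPred (h i), by funext i; simp⟩

theorem snoc_comp_castSucc {m p : ℕ} (e : Fin m → A) (y : A) (s : Fin p → Fin m) :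
    (Fin.snoc e y : Fin (m + 1) → A) ∘ (Fin.castSucc ∘ s) = e ∘ s := by
  funext i
  simp

/-- The forth step of the back-and-forth argument; the back step is its mirror image. -/
theorem Matched.extend {M : (relLanguage r).Structure A} {N : (relLanguage r).Structure B}
    {γ : A → Fin l} {δ : B → Fin l} {m : ℕ} {e : Fin m → A} {f : Fin m → B}
    (h : Matched M N γ δ e f) (hM : M ∈ colouredClass r I γ) (hN : ExtensionProperty I N δ m)
    {x : A} (hx : x ∉ Set.range e) :
    ∃ y, Matched M N γ δ (Fin.snoc e x : Fin (m + 1) → A) (Fin.snoc f y : Fin (m + 1) → B) := by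
  obtain ⟨y, hy, hyc, hyT⟩ := hN f h.inj_right (γ x)
    (pullback M (Fin.snoc e x : Fin (m + 1) → A)) (by
      refine pullback_mem hM _ fun i => ?_
      refine Fin.lastCases ?_ (fun i => ?_) i
      · simp
      · simp [h.colour])
  refine ⟨y, snoc_injective h.inj_left hx, snoc_injective h.inj_right hy, fun i => ?_,
    fun k t => ?_⟩
  · refine Fin.lastCases ?_ (fun i => ?_) i
    · simp [hyc]
    · simp [h.colour]
  · by_cases ht : ∃ i, t i = Fin.last m
    · exact (hyT k t ht).symm
    · obtain ⟨s, rfl⟩ := exists_castSucc_comp ht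
      rw [snoc_comp_castSucc, snoc_comp_castSucc]
      exact h.rel k s

theorem snoc_comp_left {m n : ℕ} (e : Fin m → A) (v : Fin n → Fin m) (j : Fin m) :
    (Fin.snoc (e ∘ v) (e j) : Fin (n + 1) → A) = e ∘ (Fin.snoc v j : Fin (n + 1) → Fin m) := by
  funext i
  refine Fin.lastCases ?_ (fun i => ?_) i <;> simp

theorem snoc_comp_new {m n : ℕ} (e : Fin m → A) (v : Fin n → Fin m) (x : A) :
    (Fin.snoc (e ∘ v) x : Fin (n + 1) → A) =
      (Fin.snoc e x : Fin (m + 1) → A) ∘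
        (Fin.snoc (Fin.castSucc ∘ v) (Fin.last m) : Fin (n + 1) → Fin (m + 1)) := by
  funext i
  refine Fin.lastCases ?_ (fun i => ?_) i <;> simp

/-- Without function symbols every term is a variable. -/
theorem term_realize_eq {n : ℕ}
    (t : (relLanguage r).Term (Empty ⊕ Fin n)) : ∃ i : Fin n, ∀ (A : Type)
      (M : (relLanguage r).Structure A) (v : Empty → A) (xs : Fin n → A),
      @FirstOrder.Language.Term.realize _ A M _ (Sum.elim v xs) t = xs i := by
  cases t with
  | var s =>
    cases s with
    | inl e => exact e.elim
    | inr i => exact ⟨i, fun _ _ _ _ => rfl⟩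
  | func f _ => exact f.elim

/-- A formula cannot separate matched tuples of two coloured structures with extension properties
for enough points. The tuples are listed as `e ∘ v` and `f ∘ v` with `e`, `f` injective, so
that repetitions are carried by `v`. -/
theorem exists_realize_iff {n : ℕ} (φ : (relLanguage r).BoundedFormula Empty n) :
    ∃ K : ℕ, ∀ (A B : Type) (M : (relLanguage r).Structure A) (N : (relLanguage r).Structure B)
      (γ : A → Fin l) (δ : B → Fin l), M ∈ colouredClass r I γ → N ∈ colouredClass r I δ →
      (∀ m < K, ExtensionProperty I M γ m) → (∀ m < K, ExtensionProperty I N δ m) →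
      ∀ (m : ℕ) (e : Fin m → A) (f : Fin m → B) (v : Fin n → Fin m), m ≤ n →
      Matched M N γ δ e f → ∀ (a : Empty → A) (b : Empty → B),
      (@FirstOrder.Language.BoundedFormula.Realize _ A M _ _ φ a (e ∘ v) ↔
        @FirstOrder.Language.BoundedFormula.Realize _ B N _ _ φ b (f ∘ v)) := by
  induction φ with
  | falsum => exact ⟨0, fun _ _ _ _ _ _ _ _ _ _ _ _ _ _ _ _ _ _ => Iff.rfl⟩
  | equal t₁ t₂ =>
    obtain ⟨i, hi⟩ := term_realize_eq t₁
    obtain ⟨j, hj⟩ := term_realize_eq t₂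
    refine ⟨0, fun A B M N γ δ _ _ _ _ m e f v _ h a b => ?_⟩
    change (_ = _) ↔ (_ = _)
    rw [hi, hj, hi, hj]
    exact ⟨fun hh => congrArg f (h.inj_left hh), fun hh => congrArg e (h.inj_right hh)⟩
  | rel R ts =>
    have := fun i => term_realize_eq (ts i)
    choose s hs using this
    refine ⟨0, fun A B M N γ δ _ _ _ _ m e f v _ h a b => ?_⟩
    obtain ⟨k, rfl⟩ := R
    change M.RelMap _ _ ↔ N.RelMap _ _
    simp only [hs]
    exact h.rel k (v ∘ s)
  | imp φ ψ ih₁ ih₂ =>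
    obtain ⟨K₁, h₁⟩ := ih₁
    obtain ⟨K₂, h₂⟩ := ih₂
    refine ⟨max K₁ K₂, fun A B M N γ δ hM hN hKM hKN m e f v hm h a b => ?_⟩
    exact imp_congr
      (h₁ A B M N γ δ hM hN (fun m hm => hKM m (lt_max_of_lt_left hm))
        (fun m hm => hKN m (lt_max_of_lt_left hm)) m e f v hm h a b)
      (h₂ A B M N γ δ hM hN (fun m hm => hKM m (lt_max_of_lt_right hm))
        (fun m hm => hKN m (lt_max_of_lt_right hm)) m e f v hm h a b)
  | @all n φ ih =>
    obtain ⟨K, hK⟩ := ih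
    refine ⟨max K (n + 1), fun A B M N γ δ hM hN hKM hKN m e f v hm h a b => ?_⟩
    have hK' := hK A B M N γ δ hM hN (fun m hm => hKM m (lt_max_of_lt_left hm))
      (fun m hm => hKN m (lt_max_of_lt_left hm))
    have hmK : m < max K (n + 1) := lt_max_of_lt_right (by omega)
    change (∀ x : A, _) ↔ (∀ y : B, _)
    constructor
    · intro hall y
      by_cases hy : y ∈ Set.range f
      · obtain ⟨j, rfl⟩ := hy
        have := hall (e j)
        rw [snoc_comp_left] at this ⊢
        exact (hK' m e f _ (by omega) h a b).1 this
      · obtain ⟨x, hx⟩ := h.symm.extend hN (hKM m hmK) hy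
        have := hall x
        rw [snoc_comp_new] at this ⊢
        exact (hK' (m + 1) _ _ _ (by omega) hx.symm a b).1 this
    · intro hall x
      by_cases hx : x ∈ Set.range e
      · obtain ⟨j, rfl⟩ := hx
        have := hall (f j)
        rw [snoc_comp_left] at this ⊢
        exact (hK' m e f _ (by omega) h a b).2 this
      · obtain ⟨y, hy⟩ := h.extend hM (hKN m hmK) hx
        have := hall y
        rw [snoc_comp_new] at this ⊢
        exact (hK' (m + 1) _ _ _ (by omega) hy a b).2 this

/-- Any two coloured structures with extension properties for enough points agree on a given
sentence. -/
theorem exists_sentenceTrue_iff (hr : ∀ k, 2 ≤ r k) (l : ℕ) (I : Set (Fin ρ))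
    (φ : (relLanguage r).Sentence) :
    ∃ K : ℕ, ∀ (A B : Type) (M : (relLanguage r).Structure A) (N : (relLanguage r).Structure B)
      (γ : A → Fin l) (δ : B → Fin l), M ∈ colouredClass r I γ → N ∈ colouredClass r I δ →
      (∀ m < K, ExtensionProperty I M γ m) → (∀ m < K, ExtensionProperty I N δ m) →
      (SentenceTrue M φ ↔ SentenceTrue N φ) := by
  obtain ⟨K, hK⟩ := exists_realize_iff (l := l) (I := I) φ
  refine ⟨K, fun A B M N γ δ hM hN hKM hKN => ?_⟩
  have key : Matched M N γ δ (Fin.elim0 : Fin 0 → A) (Fin.elim0 : Fin 0 → B) :=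
    ⟨fun i => i.elim0, fun i => i.elim0, fun i => i.elim0,
      fun k t => (t ⟨0, by have := hr k; omega⟩).elim0⟩
  have := hK A B M N γ δ hM hN hKM hKN 0 _ _ Fin.elim0 le_rfl key default default
  convert this using 1 <;>
  · unfold SentenceTrue FirstOrder.Language.Sentence.Realize FirstOrder.Language.Formula.Realize
    congr!

/-! ### The formula defining the colour classes -/

/-- The tuple `w`, listing one vertex for every colour, has all its injective subtuples in
`R_k`. -/
def IsRainbow (M : (relLanguage r).Structure A) (k : Fin ρ) (w : Fin l → A) : Prop :=
  ∀ t : Fin (r k) ↪ Fin l, RelHolds M k (w ∘ t)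

/-- The formula saying that, for some colour `c`, some vertices indexed by the other colours form
a rainbow tuple both with `x` and with `y` in position `c`. -/
noncomputable def sameColour (l : ℕ) (k : Fin ρ) : (relLanguage r).Formula (Fin 2) :=
  FirstOrder.Language.Formula.iExs (Fin l) <|
    FirstOrder.Language.Formula.iSup fun c : Fin l =>
      FirstOrder.Language.Formula.iInf fun p : Fin 2 × (Fin (r k) ↪ Fin l) =>
        (relSymbol r k).formula fun i =>
          FirstOrder.Language.Term.var (if p.2 i = c then Sum.inl p.1 else Sum.inr (p.2 i))

theorem formulaTrue_sameColour {M : (relLanguage r).Structure A} {k : Fin ρ} {a b : A} :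
    FormulaTrue M (sameColour l k) a b ↔ ∃ (z : Fin l → A) (c : Fin l),
      IsRainbow M k (Function.update z c a) ∧ IsRainbow M k (Function.update z c b) := by
  let := M
  unfold FormulaTrue sameColour
  rw [FirstOrder.Language.Formula.realize_iExs]
  refine exists_congr fun z => ?_
  rw [FirstOrder.Language.Formula.realize_iSup]
  refine exists_congr fun c => ?_
  rw [FirstOrder.Language.Formula.realize_iInf]
  have key : ∀ (j : Fin 2) (t : Fin (r k) ↪ Fin l),
      (FirstOrder.Language.Formula.Realize ((relSymbol r k).formula fun i =>
          FirstOrder.Language.Term.var (if t i = c then Sum.inl j else Sum.inr (t i)))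
        (Sum.elim ![a, b] z)) ↔ RelHolds M k (Function.update z c (![a, b] j) ∘ t) := by
    intro j t
    rw [FirstOrder.Language.Formula.realize_rel]
    unfold RelHolds
    refine iff_of_eq (congrArg _ ?_)
    funext i
    by_cases h : t i = c <;> simp [h]
  constructor
  · exact fun h => ⟨fun t => (key 0 t).1 (h (0, t)), fun t => (key 1 t).1 (h (1, t))⟩
  · rintro ⟨h₀, h₁⟩ ⟨j, t⟩
    rw [key]
    fin_cases j
    exacts [h₀ t, h₁ t]

theorem exists_embedding_of_ne {p : ℕ} (hp : 2 ≤ p) (hpl : p ≤ l) {i j : Fin l} (hij : i ≠ j) :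
    ∃ (t : Fin p ↪ Fin l) (u v : Fin p), u ≠ v ∧ t u = i ∧ t v = j := by
  obtain ⟨s, hs, hcard⟩ := Finset.exists_superset_card_eq (s := {i, j}) (n := p)
    (by rw [Finset.card_pair hij]; exact hp) (by simpa using hpl)
  have hi : i ∈ s := hs (by simp)
  have hj : j ∈ s := hs (by simp)
  let e := s.equivFinOfCardEq hcard
  refine ⟨e.symm.toEmbedding.trans (Function.Embedding.subtype _), e ⟨i, hi⟩, e ⟨j, hj⟩, ?_, ?_, ?_⟩
  · simpa using hij
  · simp
  · simp

theorem IsRainbow.bijective {M : (relLanguage r).Structure A} {k : Fin ρ} {w : Fin l → A}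
    (h : IsRainbow M k w) (hr : 2 ≤ r k) (hrl : r k ≤ l) {γ : A → Fin l}
    (hγ : IsStrongColouring M γ) : Function.Bijective (γ ∘ w) := by
  refine Finite.injective_iff_bijective.1 fun i j hij => ?_
  by_contra hne
  obtain ⟨t, u, v, huv, rfl, rfl⟩ := exists_embedding_of_ne hr hrl hne
  exact hγ k _ (h t) u v huv hij

theorem eq_of_bijective_update {γ : A → Fin l} {z : Fin l → A} {c : Fin l} {a b : A}
    (ha : Function.Bijective (γ ∘ Function.update z c a))
    (hb : Function.Bijective (γ ∘ Function.update z c b)) : γ a = γ b := by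
  obtain ⟨i, hi⟩ := hb.2 (γ a)
  by_cases hic : i = c
  · subst hic
    simpa using hi.symm
  · refine absurd (ha.1 (a₁ := i) (a₂ := c) ?_) hic
    simpa [hic] using hi

/-- Vertices in the relation `sameColour` have the same colour in every strong colouring, since the
other vertices of a common rainbow tuple leave only one colour for them. -/
theorem eq_of_sameColour {M : (relLanguage r).Structure A} {k : Fin ρ} (hr : 2 ≤ r k)
    (hrl : r k ≤ l) {γ : A → Fin l} (hγ : IsStrongColouring M γ) {a b : A}
    (h : FormulaTrue M (sameColour l k) a b) : γ a = γ b := by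
  obtain ⟨z, c, h₁, h₂⟩ := formulaTrue_sameColour.1 h
  exact eq_of_bijective_update (h₁.bijective hr hrl hγ) (h₂.bijective hr hrl hγ)

/-- If some strong colouring has its colour classes inside the relation `sameColour`, then this
relation is the partition of every strong colouring. -/
theorem colour_eq_iff {M : (relLanguage r).Structure A} {k : Fin ρ} (hr : 2 ≤ r k)
    (hrl : r k ≤ l) {γ : A → Fin l} (hγ : IsStrongColouring M γ)
    (h : ∀ a b, γ a = γ b → FormulaTrue M (sameColour l k) a b)
    {γ' : A → Fin l} (hγ' : IsStrongColouring M γ') (a b : A) :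
    γ' a = γ' b ↔ FormulaTrue M (sameColour l k) a b := by
  refine ⟨fun hab => ?_, eq_of_sameColour hr hrl hγ'⟩
  obtain ⟨z, c, hz, -⟩ := formulaTrue_sameColour.1 (h a a rfl)
  -- `b` has the `γ`-colour of some member of a rainbow tuple through `a`, hence its `γ'`-colour.
  obtain ⟨i, hi⟩ := (hz.bijective hr hrl hγ).2 (γ b)
  have h₁ := eq_of_sameColour hr hrl hγ' (h _ _ hi)
  have h₂ : i = c := (hz.bijective hr hrl hγ').1 (by simpa [← hab] using h₁)
  subst h₂
  exact h a b (by simpa using hi)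

/-- The extension property in which the demanded one-point extension has all the relations that
the colours allow. -/
theorem exists_full_extension {M : (relLanguage r).Structure A} {γ : A → Fin l} {X : Finset A}
    (h : ExtensionProperty I M γ X.card) (c : Fin l) :
    ∃ y, y ∉ X ∧ γ y = c ∧ ∀ k (t : Fin (r k) → A), (∀ i, t i ∈ X ∨ t i = y) →
      (∃ i, t i = y) → StronglyMultichromatic γ t → RelHolds M k t := by
  set e : Fin X.card → A := fun i => X.equivFin.symm i with he
  obtain ⟨y, hy, hyc, hyT⟩ := h e
    (fun i j hij => X.equivFin.symm.injective (Subtype.ext hij)) c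
    (ofRel fun k t => StronglyMultichromatic (Fin.snoc (γ ∘ e) c : Fin (X.card + 1) → Fin l) t)
    ⟨fun k a ha => ha, fun k _ a ha π i j hij => ha _ _ (π.injective.ne hij)⟩
  refine ⟨y, fun hyX => hy ⟨X.equivFin ⟨y, hyX⟩, by simp [he]⟩, hyc, fun k t ht hyt hm => ?_⟩
  have : ∀ i, ∃ j, (Fin.snoc e y : Fin (X.card + 1) → A) j = t i := by
    intro i
    rcases ht i with hi | hi
    · exact ⟨Fin.castSucc (X.equivFin ⟨t i, hi⟩), by simp [he]⟩
    · exact ⟨Fin.last _, by simp [hi]⟩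
  choose s hs using this
  have hst : (Fin.snoc e y : Fin (X.card + 1) → A) ∘ s = t := funext hs
  have hγ : ∀ j, (Fin.snoc (γ ∘ e) c : Fin (X.card + 1) → Fin l) j =
      γ ((Fin.snoc e y : Fin (X.card + 1) → A) j) := by
    intro j
    refine Fin.lastCases ?_ (fun j => ?_) j
    · simp [hyc]
    · simp
  rw [← hst]
  refine (hyT k s ?_).2 fun i j hij => ?_
  · obtain ⟨i, hi⟩ := hyt
    refine ⟨i, ?_⟩
    by_contra hne
    refine hy ⟨(s i).castPred hne, ?_⟩
    rw [← hi, ← hs i]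
    conv_rhs => rw [← Fin.castSucc_castPred (s i) hne, Fin.snoc_castSucc]
  · rw [hγ, hγ, hs, hs]
    exact hm i j hij

/-- Vertices of the colours in `C` can be added to a small set `X` one after another, each of them
with all the relations that the colours allow. -/
theorem exists_full_extensions {M : (relLanguage r).Structure A} {γ : A → Fin l} {K : ℕ}
    (h : ∀ m < K, ExtensionProperty I M γ m) (X : Finset A) (a : A) (C : Finset (Fin l))
    (hC : X.card + C.card ≤ K) :
    ∃ z : Fin l → A, (∀ c ∈ C, γ (z c) = c) ∧ ∀ k (t : Fin (r k) → A),
      (∀ i, t i ∈ X ∨ t i ∈ z '' C) → (∃ i, t i ∈ z '' C) → StronglyMultichromatic γ t →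
        RelHolds M k t := by
  classical
  induction C using Finset.induction_on with
  | empty => exact ⟨fun _ => a, by simp, by simp⟩
  | insert c C hc ih =>
    rw [Finset.card_insert_of_notMem hc] at hC
    obtain ⟨z, hz, hzt⟩ := ih (by omega)
    have hcard : (X ∪ C.image z).card < K := by
      have := Finset.card_union_le X (C.image z)
      have := Finset.card_image_le (s := C) (f := z)
      omega
    obtain ⟨y, -, hyc, hy⟩ := exists_full_extension (h _ hcard) c
    have hzC : ∀ c' ∈ C, Function.update z c y c' = z c' := fun c' hc' =>
      Function.update_of_ne (fun heq => hc (by rwa [heq] at hc')) y z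
    have himage : Function.update z c y '' (insert c C : Finset (Fin l)) = insert y (z '' C) := by
      rw [Finset.coe_insert, Set.image_insert_eq, Function.update_self]
      congr 1
      exact Set.image_congr fun c' hc' => hzC c' hc'
    refine ⟨Function.update z c y, fun c' hc' => ?_, fun k t ht hti hm => ?_⟩
    · rcases Finset.mem_insert.1 hc' with rfl | hc'
      · simpa using hyc
      · rw [hzC c' hc']
        exact hz c' hc'
    · rw [himage] at ht hti
      by_cases hty : ∃ i, t i = y
      · refine hy k t (fun i => ?_) hty hm
        have := ht i
        simp only [Set.mem_insert_iff, Set.mem_image, Finset.mem_coe] at this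
        simp only [Finset.mem_union, Finset.mem_image]
        rcases this with h | h | h
        exacts [Or.inl (Or.inl h), Or.inr h, Or.inl (Or.inr h)]
      · push Not at hty
        refine hzt k t (fun i => ?_) ?_ hm
        · exact (ht i).imp_right fun hi => hi.resolve_left (hty i)
        · obtain ⟨i, hi⟩ := hti
          exact ⟨i, hi.resolve_left (hty i)⟩

/-- Given the extension properties, rainbows through two vertices of the same colour are built by
adding one new vertex of each other colour to both of them. -/
theorem sameColour_of_eq {M : (relLanguage r).Structure A} {γ : A → Fin l} {k : Fin ρ}
    (hr : 2 ≤ r k) (h : ∀ m < l + 2, ExtensionProperty I M γ m) {a b : A} (hab : γ a = γ b) :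
    FormulaTrue M (sameColour l k) a b := by
  classical
  obtain ⟨z, hz, hzt⟩ := exists_full_extensions h {a, b} a (Finset.univ.erase (γ a)) (by
    have := Finset.card_le_two (a := a) (b := b)
    have := Finset.card_le_univ (Finset.univ.erase (γ a))
    simp only [Fintype.card_fin] at this
    omega)
  have key : ∀ x, x ∈ ({a, b} : Finset A) → γ x = γ a →
      IsRainbow M k (Function.update z (γ a) x) := by
    intro x hx hxa t
    have hupd : ∀ c, c ≠ γ a → Function.update z (γ a) x c ∈
        z '' (Finset.univ.erase (γ a) : Finset (Fin l)) := fun c hc => by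
      rw [Function.update_of_ne hc]
      exact ⟨c, by simpa using hc, rfl⟩
    have hcol : ∀ c, γ (Function.update z (γ a) x c) = c := fun c => by
      by_cases hc : c = γ a
      · rw [hc, Function.update_self, hxa]
      · rw [Function.update_of_ne hc]
        exact hz c (by simpa using hc)
    refine hzt k _ (fun i => ?_) ?_ fun i j hij => ?_
    · by_cases hi : t i = γ a
      · left
        simpa [hi] using hx
      · exact Or.inr (hupd _ hi)
    · -- The injective tuple `t` has at least two entries, so one differs from the colour of `a`.
      by_contra hne
      push Not at hne
      have hall : ∀ i, t i = γ a := fun i => by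
        by_contra hi
        exact hne i (hupd _ hi)
      have := t.injective ((hall ⟨0, by omega⟩).trans (hall ⟨1, by omega⟩).symm)
      simp at this
    · rw [Function.comp_apply, Function.comp_apply, hcol, hcol]
      exact t.injective.ne hij
  exact formulaTrue_sameColour.2
    ⟨z, γ a, key a (by simp) rfl, key b (by simp) hab.symm⟩

/-! ### Extension properties for balanced colourings -/

instance (r : Fin ρ → ℕ) (n : ℕ) : Finite ((relLanguage r).Structure (Fin n)) :=
  finite_structure r n

/-- The structure obtained from `M` by giving the tuples from `e, y` in which `y` occurs the
relations prescribed by `T`. -/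
@[reducible]
def modifyAt {m : ℕ} (M : (relLanguage r).Structure A) (e : Fin m → A)
    (T : (relLanguage r).Structure (Fin (m + 1))) (y : A) : (relLanguage r).Structure A :=
  ofRel fun k a =>
    (∃ t, (∃ i, t i = Fin.last m) ∧ (Fin.snoc e y : Fin (m + 1) → A) ∘ t = a ∧ RelHolds T k t) ∨
      ((¬ ∃ t, (∃ i, t i = Fin.last m) ∧ (Fin.snoc e y : Fin (m + 1) → A) ∘ t = a) ∧
        RelHolds M k a)

section modifyAt

variable {m : ℕ} {M : (relLanguage r).Structure A} {e : Fin m → A}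
    {T : (relLanguage r).Structure (Fin (m + 1))} {y : A}

theorem realizes_modifyAt (he : Function.Injective e) (hy : y ∉ Set.range e) :
    Realizes (modifyAt M e T y) e T y := by
  intro k t ht
  rw [relHolds_ofRel]
  constructor
  · rintro (⟨s, -, hs, h⟩ | ⟨h, -⟩)
    · rwa [← (snoc_injective he hy).comp_left hs]
    · exact absurd ⟨t, ht, rfl⟩ h
  · exact fun h => Or.inl ⟨t, ht, rfl, h⟩

theorem relHolds_modifyAt {k : Fin ρ} {a : Fin (r k) → A} (ha : ∀ i, a i ≠ y) :
    RelHolds (modifyAt M e T y) k a ↔ RelHolds M k a := by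
  have : ¬ ∃ t, (∃ i, t i = Fin.last m) ∧ (Fin.snoc e y : Fin (m + 1) → A) ∘ t = a := by
    rintro ⟨t, ⟨i, hi⟩, rfl⟩
    exact ha i (by simp [hi])
  rw [relHolds_ofRel]
  constructor
  · rintro (⟨s, h, hs, -⟩ | ⟨-, h⟩)
    · exact absurd ⟨s, h, hs⟩ this
    · exact h
  · exact fun h => Or.inr ⟨this, h⟩

theorem realizes_modifyAt_iff {y' : A} (hne : y' ≠ y) (hy : y ∉ Set.range e) :
    Realizes (modifyAt M e T y) e T y' ↔ Realizes M e T y' := by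
  refine forall_congr' fun k => forall_congr' fun t => imp_congr_right fun _ => ?_
  rw [relHolds_modifyAt]
  intro i
  simp only [Function.comp_apply]
  refine Fin.lastCases ?_ (fun j => ?_) (t i)
  · simpa using hne
  · simpa using fun h => hy ⟨j, h⟩

theorem modifyAt_mem {γ : A → Fin l} (hM : M ∈ colouredClass r I γ)
    (hT : T ∈ colouredClass r I (Fin.snoc (γ ∘ e) (γ y) : Fin (m + 1) → Fin l)) :
    modifyAt M e T y ∈ colouredClass r I γ := by
  have hγ : ∀ j, γ ((Fin.snoc e y : Fin (m + 1) → A) j) =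
      (Fin.snoc (γ ∘ e) (γ y) : Fin (m + 1) → Fin l) j := by
    intro j
    refine Fin.lastCases ?_ (fun j => ?_) j <;> simp
  refine ⟨fun k a ha => ?_, fun k hk a ha π => ?_⟩
  · rw [relHolds_ofRel] at ha
    rcases ha with ⟨t, -, rfl, ht⟩ | ⟨-, ha⟩
    · intro i j hij
      have := hT.1 k t ht i j hij
      rwa [← hγ, ← hγ] at this
    · exact hM.1 k a ha
  · rw [relHolds_ofRel] at ha
    rcases ha with ⟨t, ⟨i, hi⟩, rfl, ht⟩ | ⟨hna, ha⟩
    · exact Or.inl ⟨fun j => t (π j), ⟨π.symm i, by simp [hi]⟩, rfl, hT.2 k hk t ht π⟩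
    · refine Or.inr ⟨?_, hM.2 k hk a ha π⟩
      rintro ⟨t, ⟨i, hi⟩, ht⟩
      refine hna ⟨fun j => t (π.symm j),
        ⟨π i, (congrArg t (π.symm_apply_apply i)).trans hi⟩, funext fun j => ?_⟩
      exact (congrFun ht (π.symm j)).trans (congrArg a (π.apply_symm_apply j))

theorem eq_of_modifyAt_eq {M' : (relLanguage r).Structure A}
    (h : modifyAt M e T y = modifyAt M' e T y)
    (h' : pullback M (Fin.snoc e y : Fin (m + 1) → A) =
      pullback M' (Fin.snoc e y : Fin (m + 1) → A)) : M = M' := by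
  refine structure_ext fun k a => ?_
  by_cases ha : ∃ t, (∃ i, t i = Fin.last m) ∧ (Fin.snoc e y : Fin (m + 1) → A) ∘ t = a
  · obtain ⟨t, -, rfl⟩ := ha
    have : RelHolds (pullback M (Fin.snoc e y : Fin (m + 1) → A)) k t ↔
      RelHolds (pullback M' (Fin.snoc e y : Fin (m + 1) → A)) k t := by rw [h']
    exact this
  · have : RelHolds (modifyAt M e T y) k a ↔ RelHolds (modifyAt M' e T y) k a := by rw [h]
    rw [relHolds_ofRel, relHolds_ofRel] at this
    have aux : ∀ N : (relLanguage r).Structure A,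
        ((∃ t, (∃ i, t i = Fin.last m) ∧ (Fin.snoc e y : Fin (m + 1) → A) ∘ t = a ∧
            RelHolds T k t) ∨
          ((¬ ∃ t, (∃ i, t i = Fin.last m) ∧ (Fin.snoc e y : Fin (m + 1) → A) ∘ t = a) ∧
            RelHolds N k a)) ↔ RelHolds N k a := by
      intro N
      constructor
      · rintro (⟨s, hs, hs', -⟩ | ⟨-, hN⟩)
        · exact absurd ⟨s, hs, hs'⟩ ha
        · exact hN
      · exact fun hN => Or.inr ⟨ha, hN⟩
    rwa [aux, aux] at this

end modifyAt

/-- The members of the coloured class in which no vertex of `Y` extends `e` as `T` prescribes. -/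
def avoiding {m : ℕ} (I : Set (Fin ρ)) (γ : A → Fin l) (e : Fin m → A)
    (T : (relLanguage r).Structure (Fin (m + 1))) (Y : Finset A) :
    Set ((relLanguage r).Structure A) :=
  {M | M ∈ colouredClass r I γ ∧ ∀ y ∈ Y, ¬ Realizes M e T y}

/-- Modifying a structure at `y` is at most `C`-to-one, with `C` the number of structures on
`m + 1` points, and does not affect the other vertices. -/
theorem ncard_avoiding_le {n m : ℕ} {γ : Fin n → Fin l} {e : Fin m → Fin n}
    (he : Function.Injective e) {T : (relLanguage r).Structure (Fin (m + 1))} {Y : Finset (Fin n)}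
    {y : Fin n} (hyY : y ∉ Y) (hy : y ∉ Set.range e)
    (hT : T ∈ colouredClass r I (Fin.snoc (γ ∘ e) (γ y) : Fin (m + 1) → Fin l)) :
    (avoiding I γ e T Y).ncard ≤ {M | M ∈ avoiding I γ e T Y ∧ Realizes M e T y}.ncard *
      Nat.card ((relLanguage r).Structure (Fin (m + 1))) := by
  rw [← Set.ncard_univ, ← Set.ncard_prod]
  refine Set.ncard_le_ncard_of_injOn
    (fun M => (modifyAt M e T y, pullback M (Fin.snoc e y : Fin (m + 1) → Fin n))) ?_ ?_
    (Set.toFinite _)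
  · intro M hM
    refine ⟨⟨⟨modifyAt_mem hM.1 hT, fun y' hy' => ?_⟩, realizes_modifyAt he hy⟩, Set.mem_univ _⟩
    rw [realizes_modifyAt_iff (ne_of_mem_of_not_mem hy' hyY) hy]
    exact hM.2 y' hy'
  · intro M _ M' _ h
    exact eq_of_modifyAt_eq (Prod.ext_iff.1 h).1 (Prod.ext_iff.1 h).2

/-- Each further vertex to be avoided costs a factor `1 - 1 / (C + 1)`. The bound
`1 - 1 / C` would do as well, but `C + 1` keeps the base positive without a look at `C`. -/
theorem ncard_avoiding_le_pow {n m : ℕ} {γ : Fin n → Fin l} {e : Fin m → Fin n}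
    (he : Function.Injective e) {c : Fin l} {T : (relLanguage r).Structure (Fin (m + 1))}
    (hT : T ∈ colouredClass r I (Fin.snoc (γ ∘ e) c : Fin (m + 1) → Fin l)) (Y : Finset (Fin n))
    (hY : ∀ y ∈ Y, y ∉ Set.range e ∧ γ y = c) :
    ((avoiding I γ e T Y).ncard : ℝ) ≤
      (1 - 1 / ((Nat.card ((relLanguage r).Structure (Fin (m + 1))) : ℝ) + 1)) ^ Y.card *
        (colouredClass r I γ).ncard := by
  classical
  set C : ℝ := (Nat.card ((relLanguage r).Structure (Fin (m + 1))) : ℝ) with hCdef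
  have hC : 0 ≤ C := Nat.cast_nonneg _
  have hq : 0 ≤ 1 - 1 / (C + 1) := by
    rw [sub_nonneg, div_le_one (by linarith)]
    linarith
  induction Y using Finset.induction_on with
  | empty => simp [avoiding]
  | insert y Y hyY ih =>
    replace ih := ih fun y' hy' => hY y' (Finset.mem_insert_of_mem hy')
    obtain ⟨hy, rfl⟩ := hY y (Finset.mem_insert_self _ _)
    have h₁ : ((avoiding I γ e T Y).ncard : ℝ) ≤
        ({M | M ∈ avoiding I γ e T Y ∧ Realizes M e T y}.ncard : ℝ) * C := by
      rw [hCdef]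
      exact_mod_cast ncard_avoiding_le he hyY hy hT
    have h₂ : (avoiding I γ e T (insert y Y)).ncard +
        {M | M ∈ avoiding I γ e T Y ∧ Realizes M e T y}.ncard = (avoiding I γ e T Y).ncard := by
      rw [← Set.ncard_union_eq _ (Set.toFinite _) (Set.toFinite _)]
      · congr 1
        ext M
        simp only [avoiding, Set.mem_union, Set.mem_ofPred_eq, Finset.forall_mem_insert]
        by_cases h : Realizes M e T y <;> simp [h]
      · refine Set.disjoint_left.2 fun M hM hM' => ?_
        exact hM.2 y (Finset.mem_insert_self _ _) hM'.2
    have h₃ : ((avoiding I γ e T (insert y Y)).ncard : ℝ) +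
        {M | M ∈ avoiding I γ e T Y ∧ Realizes M e T y}.ncard = (avoiding I γ e T Y).ncard := by
      exact_mod_cast h₂
    rw [Finset.card_insert_of_notMem hyY, pow_succ', mul_assoc]
    refine le_trans ?_ (mul_le_mul_of_nonneg_left ih hq)
    have h₄ : ((avoiding I γ e T Y).ncard : ℝ) / (C + 1) ≤
        {M | M ∈ avoiding I γ e T Y ∧ Realizes M e T y}.ncard := by
      rw [div_le_iff₀ (by linarith)]
      nlinarith [(Nat.cast_nonneg _ :
        (0 : ℝ) ≤ {M | M ∈ avoiding I γ e T Y ∧ Realizes M e T y}.ncard)]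
    have : (1 - 1 / (C + 1)) * ((avoiding I γ e T Y).ncard : ℝ) =
        (avoiding I γ e T Y).ncard - ((avoiding I γ e T Y).ncard : ℝ) / (C + 1) := by ring
    rw [this]
    linarith

/-- Every colour class has at least half of its share `n / l` of the vertices. -/
def Balanced {n : ℕ} (γ : Fin n → Fin l) : Prop :=
  ∀ c, n ≤ 2 * l * (Finset.univ.filter fun a => γ a = c).card

theorem ncard_avoiding_le_of_balanced {n m : ℕ} {γ : Fin n → Fin l} (hγ : Balanced γ)
    {e : Fin m → Fin n} (he : Function.Injective e) {c : Fin l}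
    {T : (relLanguage r).Structure (Fin (m + 1))}
    (hT : T ∈ colouredClass r I (Fin.snoc (γ ∘ e) c : Fin (m + 1) → Fin l)) {s : ℝ} (hs : 0 < s)
    (hs1 : s < 1)
    (hsq : s ^ (2 * l) = 1 - 1 / ((Nat.card ((relLanguage r).Structure (Fin (m + 1))) : ℝ) + 1)) :
    ({M | M ∈ colouredClass r I γ ∧ ¬ ∃ y, y ∉ Set.range e ∧ γ y = c ∧
      Realizes M e T y}.ncard : ℝ) ≤ s ^ n / s ^ (2 * l * m) * (colouredClass r I γ).ncard := by
  classical
  set Y : Finset (Fin n) :=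
    (Finset.univ.filter fun a => γ a = c) \ Finset.univ.image e with hYdef
  have hY : ∀ y ∈ Y, y ∉ Set.range e ∧ γ y = c := by
    intro y hy
    simp only [hYdef, Finset.mem_sdiff, Finset.mem_filter, Finset.mem_univ, true_and,
      Finset.mem_image, not_exists] at hy
    exact ⟨fun ⟨i, hi⟩ => hy.2 i hi, hy.1⟩
  have hcard : n ≤ 2 * l * Y.card + 2 * l * m := by
    have h₁ := Finset.le_card_sdiff (Finset.univ.image e) (Finset.univ.filter fun a => γ a = c)
    have h₂ : (Finset.univ.image e).card ≤ m :=
      Finset.card_image_le.trans (by simp)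
    have h₃ : (Finset.univ.filter fun a => γ a = c).card ≤ Y.card + m := by
      rw [hYdef]
      omega
    calc n ≤ _ := hγ c
      _ ≤ 2 * l * (Y.card + m) := Nat.mul_le_mul_left _ h₃
      _ = _ := by ring
  have hsub : {M | M ∈ colouredClass r I γ ∧ ¬ ∃ y, y ∉ Set.range e ∧ γ y = c ∧
      Realizes M e T y} ⊆ avoiding I γ e T Y := by
    rintro M ⟨hM, h⟩
    exact ⟨hM, fun y hy hr => h ⟨y, (hY y hy).1, (hY y hy).2, hr⟩⟩
  calc _ ≤ ((avoiding I γ e T Y).ncard : ℝ) := by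
        exact_mod_cast Set.ncard_le_ncard hsub (Set.toFinite _)
    _ ≤ _ := ncard_avoiding_le_pow he hT Y hY
    _ ≤ _ := by
        refine mul_le_mul_of_nonneg_right ?_ (Nat.cast_nonneg _)
        rw [← hsq, ← pow_mul, le_div_iff₀ (pow_pos hs _), ← pow_add]
        exact pow_le_pow_of_le_one hs.le hs1.le hcard

/-- A union bound over the tuple, the colour and the extension, of which there are polynomially
many, against the exponentially small proportions for each of them. -/
theorem exists_extensionProperty_bound (hl : 0 < l) (r : Fin ρ → ℕ) (I : Set (Fin ρ)) (m : ℕ) :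
    ∃ ε : ℕ → ℝ, Tendsto ε atTop (𝓝 0) ∧ ∀ (n : ℕ) (γ : Fin n → Fin l), Balanced γ →
      ({M | M ∈ colouredClass r I γ ∧ ¬ ExtensionProperty I M γ m}.ncard : ℝ) ≤
        ε n * (colouredClass r I γ).ncard := by
  classical
  set S := (relLanguage r).Structure (Fin (m + 1))
  let _ : Fintype S := Fintype.ofFinite S
  set C : ℝ := (Nat.card S : ℝ) with hC
  have hC0 : 0 < C := by
    have : Nonempty S := ⟨ofRel fun _ _ => False⟩
    exact Nat.cast_pos.2 Nat.card_pos
  have hq : 0 < 1 - 1 / (C + 1) := by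
    rw [sub_pos, div_lt_one (by linarith)]
    linarith
  have hq1 : 1 - 1 / (C + 1) < 1 := sub_lt_self _ (by positivity)
  -- A colour class has about `n / (2 * l)` candidates, so the base of the bound in terms of `n` is
  -- a root of order `2 * l`.
  set s : ℝ := (1 - 1 / (C + 1)) ^ (((2 * l : ℕ) : ℝ)⁻¹) with hsdef
  have hs : 0 < s := Real.rpow_pos_of_pos hq _
  have hs1 : s < 1 := Real.rpow_lt_one hq.le hq1 (by positivity)
  have hsq : s ^ (2 * l) = 1 - 1 / (C + 1) := Real.rpow_inv_natCast_pow hq.le (by omega)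
  refine ⟨fun n => (n : ℝ) ^ m * s ^ n * (l * C / s ^ (2 * l * m)), ?_, fun n γ hγ => ?_⟩
  · simpa using (tendsto_pow_const_mul_const_pow_of_lt_one m hs.le hs1).mul_const
      (l * C / s ^ (2 * l * m))
  · set bad : (Fin m → Fin n) × Fin l × S → Set ((relLanguage r).Structure (Fin n)) := fun p =>
      {M | M ∈ colouredClass r I γ ∧ Function.Injective p.1 ∧
        p.2.2 ∈ colouredClass r I (Fin.snoc (γ ∘ p.1) p.2.1 : Fin (m + 1) → Fin l) ∧
        ¬ ∃ y, y ∉ Set.range p.1 ∧ γ y = p.2.1 ∧ Realizes M p.1 p.2.2 y} with hbad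
    have hsub : {M | M ∈ colouredClass r I γ ∧ ¬ ExtensionProperty I M γ m} ⊆ ⋃ p, bad p := by
      rintro M ⟨hM, h⟩
      unfold ExtensionProperty at h
      push Not at h
      obtain ⟨e, he, c, T, hT, h⟩ := h
      refine Set.mem_iUnion.2 ⟨(e, c, T), hM, he, hT, ?_⟩
      rintro ⟨y, h₁, h₂, h₃⟩
      exact h y h₁ h₂ h₃
    have hle : ∀ p, ((bad p).ncard : ℝ) ≤
        s ^ n / s ^ (2 * l * m) * (colouredClass r I γ).ncard := by
      rintro ⟨e, c, T⟩
      by_cases h : Function.Injective e ∧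
          T ∈ colouredClass r I (Fin.snoc (γ ∘ e) c : Fin (m + 1) → Fin l)
      · refine le_trans ?_ (ncard_avoiding_le_of_balanced hγ h.1 h.2 hs hs1 hsq)
        refine Nat.cast_le.2 (Set.ncard_le_ncard (fun M hM => ?_) (Set.toFinite _))
        exact ⟨hM.1, hM.2.2.2⟩
      · have : bad (e, c, T) = ∅ :=
          Set.eq_empty_of_forall_notMem fun M hM => h ⟨hM.2.1, hM.2.2.1⟩
        rw [this, Set.ncard_empty, Nat.cast_zero]
        positivity
    calc _ ≤ (((⋃ p, bad p).ncard : ℕ) : ℝ) := by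
          exact_mod_cast Set.ncard_le_ncard hsub (Set.toFinite _)
      _ ≤ ∑ p, ((bad p).ncard : ℝ) := by exact_mod_cast Set.ncard_iUnion_le_of_fintype bad
      _ ≤ ∑ _p : (Fin m → Fin n) × Fin l × S,
            s ^ n / s ^ (2 * l * m) * (colouredClass r I γ).ncard :=
          Finset.sum_le_sum fun p _ => hle p
      _ = _ := by
          rw [Finset.sum_const, Finset.card_univ, nsmul_eq_mul, Fintype.card_prod,
            Fintype.card_prod, ← Nat.card_eq_fintype_card (α := S)]
          simp only [Fintype.card_fun, Fintype.card_fin, Nat.cast_mul, Nat.cast_pow, ← hC]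
          ring

/-- Uniformly in the balanced colouring `γ`, almost all structures coloured by `γ` have the
extension properties for fewer than `K` points. -/
theorem exists_extensionProperties_bound (hl : 0 < l) (r : Fin ρ → ℕ) (I : Set (Fin ρ)) (K : ℕ) :
    ∃ ε : ℕ → ℝ, Tendsto ε atTop (𝓝 0) ∧ ∀ (n : ℕ) (γ : Fin n → Fin l), Balanced γ →
      ({M | M ∈ colouredClass r I γ ∧ ¬ ∀ m < K, ExtensionProperty I M γ m}.ncard : ℝ) ≤
        ε n * (colouredClass r I γ).ncard := by
  choose ε hε hb using exists_extensionProperty_bound hl r I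
  refine ⟨fun n => ∑ m ∈ Finset.range K, ε m n, ?_, fun n γ hγ => ?_⟩
  · simpa using tendsto_finsetSum (Finset.range K) fun m _ => hε m
  · have hsub : {M | M ∈ colouredClass r I γ ∧ ¬ ∀ m < K, ExtensionProperty I M γ m} ⊆
        ⋃ m ∈ Finset.range K, {M | M ∈ colouredClass r I γ ∧ ¬ ExtensionProperty I M γ m} := by
      rintro M ⟨hM, h⟩
      push Not at h
      obtain ⟨m, hm, h⟩ := h
      simp only [Set.mem_iUnion]
      exact ⟨m, Finset.mem_range.2 hm, hM, h⟩
    calc _ ≤ ((∑ m ∈ Finset.range K,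
          {M | M ∈ colouredClass r I γ ∧ ¬ ExtensionProperty I M γ m}.ncard : ℕ) : ℝ) :=
          Nat.cast_le.2 ((Set.ncard_le_ncard hsub (Set.toFinite _)).trans
            (Finset.set_ncard_biUnion_le _ _))
      _ ≤ _ := by
          rw [Nat.cast_sum, Finset.sum_mul]
          exact Finset.sum_le_sum fun m _ => hb m n γ hγ

/-! ### Elementary symmetric polynomials on the simplex -/

section elemSymm

variable {ι : Type*}

/-- The elementary symmetric polynomial of degree `k` in the variables `x i`, `i ∈ s`. -/
def elemSymm (k : ℕ) (s : Finset ι) (x : ι → ℝ) : ℝ :=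
  ∑ u ∈ s.powersetCard k, ∏ i ∈ u, x i

theorem elemSymm_insert [DecidableEq ι] (k : ℕ) {s : Finset ι} {a : ι} (ha : a ∉ s) (x : ι → ℝ) :
    elemSymm (k + 1) (insert a s) x = elemSymm (k + 1) s x + x a * elemSymm k s x := by
  unfold elemSymm
  rw [Finset.powersetCard_succ_insert ha, Finset.sum_union, Finset.sum_image, Finset.mul_sum]
  · congr 1
    refine Finset.sum_congr rfl fun u hu => ?_
    exact Finset.prod_insert fun h => ha ((Finset.mem_powersetCard.1 hu).1 h)
  · intro u hu v hv huv
    have hu' : a ∉ u := fun h => ha ((Finset.mem_powersetCard.1 hu).1 h)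
    have hv' : a ∉ v := fun h => ha ((Finset.mem_powersetCard.1 hv).1 h)
    rw [← Finset.erase_insert hu', ← Finset.erase_insert hv', huv]
  · refine Finset.disjoint_left.2 fun u hu hu' => ?_
    obtain ⟨v, -, rfl⟩ := Finset.mem_image.1 hu'
    exact ha ((Finset.mem_powersetCard.1 hu).1 (Finset.mem_insert_self _ _))

theorem elemSymm_insert_insert [DecidableEq ι] (k : ℕ) {s : Finset ι} {a b : ι} (hab : a ≠ b) (ha : a ∉ s)
    (hb : b ∉ s) (x : ι → ℝ) :
    elemSymm (k + 2) (insert a (insert b s)) x = elemSymm (k + 2) s x +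
      (x a + x b) * elemSymm (k + 1) s x + x a * x b * elemSymm k s x := by
  rw [elemSymm_insert _ (by simp [hab, ha]), elemSymm_insert _ hb, elemSymm_insert _ hb]
  ring

theorem elemSymm_congr {k : ℕ} {s : Finset ι} {x y : ι → ℝ} (h : ∀ i ∈ s, x i = y i) :
    elemSymm k s x = elemSymm k s y :=
  Finset.sum_congr rfl fun _ hu =>
    Finset.prod_congr rfl fun i hi => h i ((Finset.mem_powersetCard.1 hu).1 hi)

theorem elemSymm_smul (k : ℕ) (s : Finset ι) (c : ℝ) (x : ι → ℝ) :
    elemSymm k s (fun i => c * x i) = c ^ k * elemSymm k s x := by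
  unfold elemSymm
  rw [Finset.mul_sum]
  refine Finset.sum_congr rfl fun u hu => ?_
  rw [Finset.prod_mul_distrib, Finset.prod_const, (Finset.mem_powersetCard.1 hu).2]

theorem elemSymm_mono {k : ℕ} {s : Finset ι} {x y : ι → ℝ} (hx : ∀ i, 0 ≤ x i)
    (h : ∀ i, x i ≤ y i) : elemSymm k s x ≤ elemSymm k s y :=
  Finset.sum_le_sum fun _ _ => Finset.prod_le_prod (fun i _ => hx i) fun i _ => h i

theorem elemSymm_pos_of_subset {k : ℕ} {s u : Finset ι} {x : ι → ℝ} (hx : ∀ i, 0 ≤ x i)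
    (hu : u ⊆ s) (hk : k ≤ u.card) (hpos : ∀ i ∈ u, 0 < x i) : 0 < elemSymm k s x := by
  obtain ⟨v, hv, hcard⟩ := Finset.exists_subset_card_eq hk
  refine Finset.sum_pos' (fun w _ => Finset.prod_nonneg fun i _ => hx i) ⟨v, ?_, ?_⟩
  · exact Finset.mem_powersetCard.2 ⟨hv.trans hu, hcard⟩
  · exact Finset.prod_pos fun i hi => hpos i (hv hi)

theorem continuous_elemSymm (k : ℕ) (s : Finset ι) : Continuous (elemSymm k s) := by
  unfold elemSymm
  fun_prop

end elemSymm

theorem const_mem_stdSimplex (hl : 0 < l) :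
    (fun _ => 1 / (l : ℝ)) ∈ stdSimplex ℝ (Fin l) := by
  refine ⟨fun _ => by positivity, ?_⟩
  rw [Finset.sum_const, Finset.card_univ, Fintype.card_fin, nsmul_eq_mul]
  field_simp

/-- Replacing two different coordinates by their mean increases the polynomial, so a maximum on
the simplex has all its coordinates equal. -/
theorem eq_of_isMaxOn_elemSymm {k : ℕ} (hk : k + 2 ≤ l) {x : Fin l → ℝ}
    (hx : x ∈ stdSimplex ℝ (Fin l))
    (hmax : ∀ y ∈ stdSimplex ℝ (Fin l),
      elemSymm (k + 2) Finset.univ y ≤ elemSymm (k + 2) Finset.univ x) (i j : Fin l) :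
    x i = x j := by
  have hl : 0 < (l : ℝ) := by exact_mod_cast (by omega : 0 < l)
  by_contra hne
  have hij : i ≠ j := fun h => hne (congrArg x h)
  set s : Finset (Fin l) := Finset.univ \ {i, j} with hs
  have hi : i ∉ s := by simp [hs]
  have hj : j ∉ s := by simp [hs]
  have huniv : (Finset.univ : Finset (Fin l)) = insert i (insert j s) := by
    ext a
    by_cases h₁ : a = i <;> by_cases h₂ : a = j <;> simp [hs, h₁, h₂]
  have hpos : 0 < elemSymm (k + 2) Finset.univ x := by
    refine lt_of_lt_of_le ?_ (hmax _ (const_mem_stdSimplex (by omega)))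
    exact elemSymm_pos_of_subset (fun _ => by positivity) (Finset.Subset.refl _)
      (by simpa using hk) fun _ _ => by positivity
  obtain ⟨u, hu, hu0⟩ := Finset.exists_ne_zero_of_sum_ne_zero hpos.ne'
  have hupos : ∀ a ∈ u, 0 < x a := fun a ha =>
    lt_of_le_of_ne (hx.1 a) fun h => hu0 (Finset.prod_eq_zero ha h.symm)
  have hspos : 0 < elemSymm k s x := by
    refine elemSymm_pos_of_subset hx.1 (u := u \ {i, j}) ?_ ?_ fun a ha =>
      hupos a (Finset.mem_sdiff.1 ha).1
    · exact Finset.sdiff_subset_sdiff (Finset.subset_univ _) (Finset.Subset.refl _)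
    · have h₁ := Finset.le_card_sdiff {i, j} u
      have h₂ := (Finset.mem_powersetCard.1 hu).2
      have h₃ := Finset.card_le_two (a := i) (b := j)
      omega
  set m : ℝ := (x i + x j) / 2 with hm
  set y : Fin l → ℝ := fun a => if a = i ∨ a = j then m else x a with hy
  have hyi : y i = m := by simp [hy]
  have hyj : y j = m := by simp [hy]
  have hys : ∀ a ∈ s, y a = x a := fun a ha => by
    have : ¬ (a = i ∨ a = j) := by simpa [hs] using ha
    simp only [hy, if_neg this]
  have hymem : y ∈ stdSimplex ℝ (Fin l) := by
    refine ⟨fun a => ?_, ?_⟩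
    · simp only [hy]
      split_ifs
      · have := hx.1 i
        have := hx.1 j
        positivity
      · exact hx.1 a
    · rw [← hx.2, huniv, Finset.sum_insert (by simp [hij, hi]), Finset.sum_insert hj,
        Finset.sum_insert (by simp [hij, hi]), Finset.sum_insert hj, hyi, hyj,
        Finset.sum_congr rfl hys, hm]
      ring
  have hle := hmax y hymem
  rw [huniv, elemSymm_insert_insert k hij hi hj, elemSymm_insert_insert k hij hi hj,
    elemSymm_congr hys, elemSymm_congr hys, elemSymm_congr hys, hyi, hyj] at hle
  have hsq : 0 < (x i - x j) ^ 2 := by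
    have := sub_ne_zero.2 hne
    positivity
  have : (m * m - x i * x j) * elemSymm k s x ≤ 0 := by
    have h2m : m + m = x i + x j := by rw [hm]; ring
    rw [h2m] at hle
    linarith
  have h4 : m * m - x i * x j = (x i - x j) ^ 2 / 4 := by rw [hm]; ring
  rw [h4] at this
  have : 0 < (x i - x j) ^ 2 / 4 * elemSymm k s x := by positivity
  linarith

/-- By compactness, the elementary symmetric polynomial stays away from its maximum on the part of
the simplex away from the centre. -/
theorem exists_elemSymm_gap {p : ℕ} (hp : 2 ≤ p) (hpl : p ≤ l) :
    ∃ δ : ℝ, 0 < δ ∧ ∀ x ∈ stdSimplex ℝ (Fin l), (∃ i, x i ≤ 1 / (2 * l)) →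
      elemSymm p (Finset.univ : Finset (Fin l)) x + δ ≤
        elemSymm p (Finset.univ : Finset (Fin l)) fun _ => 1 / (l : ℝ) := by
  obtain ⟨k, rfl⟩ := Nat.exists_eq_add_of_le' hp
  have hl : 0 < (l : ℝ) := by exact_mod_cast (by omega : 0 < l)
  have hcont := continuous_elemSymm (k + 2) (Finset.univ : Finset (Fin l))
  have hunique : ∀ x ∈ stdSimplex ℝ (Fin l), (∀ y ∈ stdSimplex ℝ (Fin l),
      elemSymm (k + 2) Finset.univ y ≤ elemSymm (k + 2) Finset.univ x) →
        x = fun _ => 1 / (l : ℝ) := by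
    intro x hx hmax
    funext i
    have hsum := hx.2
    rw [Finset.sum_congr rfl fun j _ => eq_of_isMaxOn_elemSymm hpl hx hmax j i,
      Finset.sum_const, Finset.card_univ, Fintype.card_fin, nsmul_eq_mul] at hsum
    field_simp
    linarith
  obtain ⟨x₁, hx₁, hmax₁⟩ := (isCompact_stdSimplex ℝ (Fin l)).exists_isMaxOn
    ⟨_, const_mem_stdSimplex (by omega)⟩ hcont.continuousOn
  have hx₁u := hunique x₁ hx₁ fun y hy => hmax₁ hy
  set K : Set (Fin l → ℝ) := stdSimplex ℝ (Fin l) ∩ ⋃ i, {x | x i ≤ 1 / (2 * l)} with hK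
  have hKc : IsCompact K := (isCompact_stdSimplex ℝ (Fin l)).inter_right
    (isClosed_iUnion_of_finite fun i => isClosed_le (continuous_apply i) continuous_const)
  rcases K.eq_empty_or_nonempty with hKe | hKne
  · refine ⟨1, one_pos, fun x hx hxi => ?_⟩
    have : x ∈ K := ⟨hx, Set.mem_iUnion.2 hxi⟩
    rw [hKe] at this
    exact this.elim
  · obtain ⟨x₀, hx₀, hmax₀⟩ := hKc.exists_isMaxOn hKne hcont.continuousOn
    refine ⟨elemSymm (k + 2) (Finset.univ : Finset (Fin l)) (fun _ => 1 / (l : ℝ)) -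
      elemSymm (k + 2) Finset.univ x₀, sub_pos.2 ?_, fun x hx hxi => ?_⟩
    · by_contra hge
      push Not at hge
      have hx₀u := hunique x₀ hx₀.1 fun y hy => by
        have := hmax₁ hy
        rw [hx₁u] at this
        exact le_trans this hge
      obtain ⟨i, hi⟩ := Set.mem_iUnion.1 hx₀.2
      rw [hx₀u] at hi
      have hi' : 1 / (l : ℝ) ≤ 1 / (2 * l) := hi
      rw [div_le_div_iff₀ hl (by positivity)] at hi'
      linarith
    · have : elemSymm (k + 2) Finset.univ x ≤ elemSymm (k + 2) Finset.univ x₀ :=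
        hmax₀ (⟨hx, Set.mem_iUnion.2 hxi⟩ : x ∈ K)
      linarith

/-! ### Counting the structures with a given colouring -/

section tuples

variable {ι : Type*} [DecidableEq ι] {p : ℕ}

theorem exists_perm_of_image_eq {a b : Fin p → ι} (hb : Function.Injective b)
    (h : Finset.univ.image a = Finset.univ.image b) : ∃ π : Equiv.Perm (Fin p), a = b ∘ π := by
  have ha : Function.Injective a := by
    have hcard : (Finset.univ.image a).card = (Finset.univ : Finset (Fin p)).card := by
      rw [h, Finset.card_image_of_injective _ hb]
    simpa using Finset.card_image_iff.1 hcard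
  have : ∀ i, ∃ j, b j = a i := fun i => by
    have : a i ∈ Finset.univ.image b := h ▸ Finset.mem_image_of_mem _ (Finset.mem_univ i)
    simpa using this
  choose f hf using this
  have hinj : Function.Injective f := fun i j hij => ha (by rw [← hf, ← hf, hij])
  exact ⟨Equiv.ofBijective f (Finite.injective_iff_bijective.1 hinj), funext fun i => (hf i).symm⟩

theorem image_comp_perm (a : Fin p → ι) (π : Equiv.Perm (Fin p)) :
    Finset.univ.image (a ∘ π) = Finset.univ.image a := by
  ext x
  simp only [Finset.mem_image, Finset.mem_univ, true_and, Function.comp_apply]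
  exact (π.surjective.exists (p := fun i => a i = x)).symm

theorem card_filter_image_eq [Fintype ι] {P : (Fin p → ι) → Prop} [DecidablePred P]
    (hinj : ∀ a, P a → Function.Injective a)
    (hperm : ∀ a, P a → ∀ π : Equiv.Perm (Fin p), P (a ∘ π)) {a : Fin p → ι} (ha : P a) :
    ((Finset.univ.filter P).filter fun b =>
      Finset.univ.image b = Finset.univ.image a).card = p.factorial := by
  have : ((Finset.univ.filter P).filter fun b => Finset.univ.image b = Finset.univ.image a) =
      Finset.univ.image fun π : Equiv.Perm (Fin p) => a ∘ π := by
    ext b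
    simp only [Finset.mem_filter, Finset.mem_univ, true_and, Finset.mem_image]
    constructor
    · rintro ⟨-, hb⟩
      obtain ⟨π, rfl⟩ := exists_perm_of_image_eq (hinj a ha) hb
      exact ⟨π, rfl⟩
    · rintro ⟨π, rfl⟩
      exact ⟨hperm a ha π, image_comp_perm a π⟩
  rw [this, Finset.card_image_of_injective, Finset.card_univ, Fintype.card_perm, Fintype.card_fin]
  intro π σ h
  exact Equiv.ext fun i => hinj a ha (congrFun h i)

/-- Every `p`-element set is enumerated by `p!` injective tuples. -/
theorem sum_injective_eq [Fintype ι] [DecidablePred (Function.Injective : (Fin p → ι) → Prop)]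
    (F : Finset ι → ℝ) :
    ∑ a ∈ Finset.univ.filter (Function.Injective : (Fin p → ι) → Prop), F (Finset.univ.image a) =
      p.factorial * ∑ s ∈ Finset.univ.powersetCard p, F s := by
  rw [← Finset.sum_fiberwise_of_maps_to (t := Finset.univ.powersetCard p)
    (g := fun a : Fin p → ι => Finset.univ.image a), Finset.mul_sum]
  · refine Finset.sum_congr rfl fun s hs => ?_
    have hcard := (Finset.mem_powersetCard.1 hs).2
    let e := s.equivFinOfCardEq hcard
    have hinj : Function.Injective fun i => (e.symm i : ι) :=
      Subtype.val_injective.comp e.symm.injective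
    have hs : Finset.univ.image (fun i => (e.symm i : ι)) = s := by
      ext x
      simp only [Finset.mem_image, Finset.mem_univ, true_and]
      exact ⟨fun ⟨i, hi⟩ => hi ▸ (e.symm i).2, fun hx => ⟨e ⟨x, hx⟩, by simp⟩⟩
    rw [Finset.sum_congr rfl (g := fun _ => F s) fun a ha => by
      rw [(Finset.mem_filter.1 ha).2], Finset.sum_const, nsmul_eq_mul]
    congr 2
    conv_lhs => rw [← hs]
    exact card_filter_image_eq (fun a h => h) (fun a h π => h.comp π.injective) hinj
  · intro a ha
    refine Finset.mem_powersetCard.2 ⟨Finset.subset_univ _, ?_⟩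
    rw [Finset.card_image_of_injective _ (Finset.mem_filter.1 ha).2, Finset.card_univ,
      Fintype.card_fin]

end tuples

/-- The size of the colour class of `c`. -/
def classSize {n : ℕ} (γ : Fin n → Fin l) (c : Fin l) : ℕ :=
  (Finset.univ.filter fun a => γ a = c).card

open Classical in
/-- The `p`-tuples whose entries have distinct colours. -/
noncomputable def multichromaticTuples {n : ℕ} (γ : Fin n → Fin l) (p : ℕ) :
    Finset (Fin p → Fin n) :=
  Finset.univ.filter fun a => StronglyMultichromatic γ a

theorem mem_multichromaticTuples {n p : ℕ} {γ : Fin n → Fin l} {a : Fin p → Fin n} :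
    a ∈ multichromaticTuples γ p ↔ StronglyMultichromatic γ a := by
  simp [multichromaticTuples]

/-- The tuples are sorted by their injective sequence of colours. -/
theorem card_multichromaticTuples {n : ℕ} (γ : Fin n → Fin l) (p : ℕ) :
    ((multichromaticTuples γ p).card : ℝ) =
      p.factorial * elemSymm p Finset.univ fun c => (classSize γ c : ℝ) := by
  classical
  unfold elemSymm
  rw [← sum_injective_eq (fun s => ∏ i ∈ s, (classSize γ i : ℝ)),
    Finset.card_eq_sum_card_fiberwise (f := fun a => γ ∘ a)
      (t := Finset.univ.filter (Function.Injective : (Fin p → Fin l) → Prop)), Nat.cast_sum]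
  · refine Finset.sum_congr rfl fun c hc => ?_
    have hc := (Finset.mem_filter.1 hc).2
    rw [Finset.prod_image fun i _ j _ h => hc h]
    have : (multichromaticTuples γ p).filter (fun a => γ ∘ a = c) =
        Fintype.piFinset fun i => Finset.univ.filter fun a => γ a = c i := by
      ext a
      simp only [Finset.mem_filter, mem_multichromaticTuples, Fintype.mem_piFinset,
        Finset.mem_univ, true_and]
      constructor
      · rintro ⟨-, rfl⟩ i
        rfl
      · intro h
        refine ⟨fun i j hij => ?_, funext h⟩
        rw [h, h]
        exact hc.ne hij
    rw [this, Fintype.card_piFinset, Nat.cast_prod]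
    rfl
  · intro a ha
    have ha := mem_multichromaticTuples.1 ha
    refine Finset.mem_coe.2 (Finset.mem_filter.2 ⟨Finset.mem_univ _, fun i j hij => ?_⟩)
    by_contra hne
    exact ha i j hne hij

open Classical in
/-- The datum on which membership of a tuple in `R_k` may depend: its set of entries when `R_k`
has to be symmetric, the tuple itself otherwise. -/
noncomputable def tupleKey {n : ℕ} (I : Set (Fin ρ)) (k : Fin ρ) (a : Fin (r k) → Fin n) :
    Finset (Fin n) ⊕ (Fin (r k) → Fin n) :=
  if k ∈ I then Sum.inl (Finset.univ.image a) else Sum.inr a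

open Classical in
/-- The keys of the tuples that are allowed in `R_k` when `γ` is a strong colouring. -/
noncomputable def allowedKeys {n : ℕ} (r : Fin ρ → ℕ) (I : Set (Fin ρ)) (γ : Fin n → Fin l)
    (k : Fin ρ) : Finset (Finset (Fin n) ⊕ (Fin (r k) → Fin n)) :=
  (multichromaticTuples γ (r k)).image (tupleKey I k)

theorem relHolds_of_tupleKey_eq {n : ℕ} {γ : Fin n → Fin l}
    {M : (relLanguage r).Structure (Fin n)} (hM : M ∈ colouredClass r I γ) {k : Fin ρ}
    {a b : Fin (r k) → Fin n} (h : tupleKey I k a = tupleKey I k b) (hb : RelHolds M k b) :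
    RelHolds M k a := by
  unfold tupleKey at h
  split_ifs at h with hk
  · obtain ⟨π, rfl⟩ := exists_perm_of_image_eq (injective_of_multichromatic (hM.1 k b hb)) (Sum.inl.inj h)
    exact hM.2 k hk b hb π
  · rwa [Sum.inr.inj h]

/-- A structure coloured by `γ` amounts to a choice of allowed keys for every relation. -/
theorem ncard_colouredClass {n : ℕ} (r : Fin ρ → ℕ) (I : Set (Fin ρ)) (γ : Fin n → Fin l) :
    (colouredClass r I γ).ncard = 2 ^ ∑ k, (allowedKeys r I γ k).card := by
  classical
  set f : (relLanguage r).Structure (Fin n) →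
      (k : Fin ρ) → Finset (Finset (Fin n) ⊕ (Fin (r k) → Fin n)) :=
    fun M k => (Finset.univ.filter fun a => RelHolds M k a).image (tupleKey I k) with hf
  have hmem : ∀ M ∈ colouredClass r I γ, ∀ k a, RelHolds M k a ↔ tupleKey I k a ∈ f M k := by
    intro M hM k a
    simp only [hf, Finset.mem_image, Finset.mem_filter, Finset.mem_univ, true_and]
    exact ⟨fun h => ⟨a, h, rfl⟩, fun ⟨b, hb, hba⟩ => relHolds_of_tupleKey_eq hM hba.symm hb⟩
  have hinj : Set.InjOn f (colouredClass r I γ) := fun M hM N hN h =>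
    structure_ext fun k a => by rw [hmem M hM, hmem N hN, h]
  have himage : f '' colouredClass r I γ =
      (Fintype.piFinset fun k => (allowedKeys r I γ k).powerset : Finset _) := by
    ext S
    rw [Finset.mem_coe, Fintype.mem_piFinset]
    constructor
    · rintro ⟨M, hM, rfl⟩ k
      refine Finset.mem_powerset.2 (Finset.image_subset_image fun a ha => ?_)
      exact mem_multichromaticTuples.2 (hM.1 k a (Finset.mem_filter.1 ha).2)
    · intro hS
      refine ⟨ofRel fun k a => StronglyMultichromatic γ a ∧ tupleKey I k a ∈ S k,
        ⟨fun k a ha => ha.1, fun k hk a ha π => ⟨fun i j hij => ha.1 _ _ (π.injective.ne hij), ?_⟩⟩,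
        funext fun k => ?_⟩
      · have : tupleKey I k (fun i => a (π i)) = tupleKey I k a := by
          unfold tupleKey
          rw [if_pos hk, if_pos hk]
          exact congrArg Sum.inl (image_comp_perm a π)
        exact this ▸ ha.2
      · ext x
        simp only [hf, Finset.mem_image, Finset.mem_filter, Finset.mem_univ, true_and,
          relHolds_ofRel]
        constructor
        · rintro ⟨a, ⟨-, ha⟩, rfl⟩
          exact ha
        · intro hx
          obtain ⟨a, ha, rfl⟩ := Finset.mem_image.1 (Finset.mem_powerset.1 (hS k) hx)
          exact ⟨a, ⟨mem_multichromaticTuples.1 ha, hx⟩, rfl⟩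
  rw [← hinj.ncard_image, himage, Set.ncard_coe_finset, Fintype.card_piFinset,
    ← Finset.prod_pow_eq_pow_sum]
  exact Finset.prod_congr rfl fun k _ => Finset.card_powerset _

/-- The number `d` of tuples with the same key depends on `k` only: it is `(r k)!` for a relation
that has to be symmetric and `1` otherwise. -/
theorem exists_card_allowedKeys (r : Fin ρ → ℕ) (I : Set (Fin ρ)) (k : Fin ρ) :
    ∃ d : ℕ, 0 < d ∧ ∀ (n : ℕ) (γ : Fin n → Fin l),
      (multichromaticTuples γ (r k)).card = (allowedKeys r I γ k).card * d := by
  classical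
  by_cases hk : k ∈ I
  · refine ⟨(r k).factorial, Nat.factorial_pos _, fun n γ => ?_⟩
    unfold allowedKeys
    rw [Finset.card_eq_sum_card_image (tupleKey I k)]
    refine Finset.sum_const_nat fun x hx => ?_
    obtain ⟨a, ha, rfl⟩ := Finset.mem_image.1 hx
    have hkey : ∀ b : Fin (r k) → Fin n, tupleKey I k b = tupleKey I k a ↔
        Finset.univ.image b = Finset.univ.image a := fun b => by
      simp [tupleKey, hk]
    simp only [hkey]
    exact card_filter_image_eq (P := fun a => StronglyMultichromatic γ a)
      (fun a h => injective_of_multichromatic h)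
      (fun a h π i j hij => h _ _ (π.injective.ne hij)) (mem_multichromaticTuples.1 ha)
  · refine ⟨1, one_pos, fun n γ => ?_⟩
    unfold allowedKeys
    rw [mul_one, Finset.card_image_of_injective]
    intro a b h
    unfold tupleKey at h
    rw [if_neg hk, if_neg hk] at h
    exact Sum.inr.inj h

/-! ### Unbalanced colourings -/

/-- The colouring by residues modulo `l`. -/
def residueColouring (hl : 0 < l) (n : ℕ) : Fin n → Fin l :=
  fun a => ⟨a % l, Nat.mod_lt _ hl⟩

theorem le_classSize_residueColouring (hl : 0 < l) (n : ℕ) (c : Fin l) :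
    ((n : ℝ) - l) * (1 / l) ≤ classSize (residueColouring hl n) c := by
  have h₁ : classSize (residueColouring hl n) c = n.count (· ≡ c [MOD l]) := by
    rw [Nat.count_eq_card_filter_range, classSize, ← Finset.card_map Fin.valEmbedding]
    congr 1
    ext x
    simp only [Finset.mem_map, Finset.mem_filter, Finset.mem_univ, true_and, Finset.mem_range,
      residueColouring, Fin.ext_iff, Nat.ModEq, Nat.mod_eq_of_lt c.2, Fin.valEmbedding_apply]
    exact ⟨fun ⟨a, ha, hx⟩ => hx ▸ ⟨a.2, ha⟩, fun ⟨hx, h⟩ => ⟨⟨x, hx⟩, h, rfl⟩⟩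
  have h₂ : n / l ≤ classSize (residueColouring hl n) c := by
    rw [h₁, Nat.count_modEq_card _ hl]
    exact Nat.le_add_right _ _
  have h₃ : (n : ℝ) ≤ l * (classSize (residueColouring hl n) c : ℝ) + l := by
    have := Nat.div_add_mod n l
    have h₄ := Nat.mod_lt n hl
    have h₅ := Nat.mul_le_mul_left l h₂
    exact_mod_cast (by omega : n ≤ l * classSize (residueColouring hl n) c + l)
  have hl' : (0 : ℝ) < l := by exact_mod_cast hl
  rw [mul_one_div, div_le_iff₀ hl']
  linarith

/-- The gap on the simplex, scaled by `n ^ p`, exceeds the rounding error of order `n ^ (p - 1)` of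
the residue colouring. -/
theorem exists_elemSymm_classSize_gap {p : ℕ} (hp : 2 ≤ p) (hpl : p ≤ l) (hl : 0 < l) :
    ∃ c : ℝ, 0 < c ∧ ∀ᶠ n : ℕ in atTop, ∀ γ : Fin n → Fin l, ¬ Balanced γ →
      elemSymm p Finset.univ (fun i => (classSize γ i : ℝ)) + c * (n : ℝ) ^ 2 ≤
        elemSymm p Finset.univ fun i => (classSize (residueColouring hl n) i : ℝ) := by
  obtain ⟨δ, hδ, hgap⟩ := exists_elemSymm_gap hp hpl
  set U : ℝ := elemSymm p (Finset.univ : Finset (Fin l)) fun _ => 1 / (l : ℝ) with hU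
  have hU0 : 0 ≤ U := Finset.sum_nonneg fun _ _ => Finset.prod_nonneg fun _ _ => by positivity
  have hl' : (0 : ℝ) < l := by exact_mod_cast hl
  refine ⟨δ / 2, by positivity, ?_⟩
  filter_upwards [eventually_ge_atTop (max l 1), eventually_ge_atTop ⌈2 * (U * p * l) / δ⌉₊]
    with n hn hn' γ hγ
  have hn1 : (1 : ℝ) ≤ n := by exact_mod_cast (le_max_right _ _).trans hn
  have hnl : (l : ℝ) ≤ n := by exact_mod_cast (le_max_left _ _).trans hn
  have hn0 : (0 : ℝ) < n := by linarith
  have hnδ : 2 * (U * p * l) ≤ n * δ := by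
    rw [← div_le_iff₀ hδ]
    exact Nat.ceil_le.1 hn'
  have hsmall : elemSymm p Finset.univ (fun i => (classSize γ i : ℝ)) ≤ (n : ℝ) ^ p * (U - δ) := by
    have heq : (fun i => (classSize γ i : ℝ)) = fun i => (n : ℝ) * ((classSize γ i : ℝ) / n) := by
      funext i
      field_simp
    rw [heq, elemSymm_smul]
    refine mul_le_mul_of_nonneg_left (le_sub_iff_add_le.2 (hgap _ ⟨fun i => ?_, ?_⟩ ?_))
      (by positivity)
    · positivity
    · rw [← Finset.sum_div, div_eq_one_iff_eq hn0.ne', ← Nat.cast_sum]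
      congr 1
      have := Finset.card_eq_sum_card_fiberwise (f := γ) (s := Finset.univ) (t := Finset.univ)
        (fun _ _ => Finset.mem_coe.2 (Finset.mem_univ _))
      rw [Finset.card_univ, Fintype.card_fin] at this
      exact this.symm
    · unfold Balanced at hγ
      push Not at hγ
      obtain ⟨i, hi⟩ := hγ
      refine ⟨i, ?_⟩
      rw [div_le_div_iff₀ hn0 (by positivity)]
      have : 2 * (l : ℝ) * classSize γ i < n := by exact_mod_cast hi
      linarith
  have hlarge : ((n : ℝ) - l) ^ p * U ≤
      elemSymm p Finset.univ fun i => (classSize (residueColouring hl n) i : ℝ) := by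
    rw [hU, ← elemSymm_smul]
    exact elemSymm_mono (fun _ => mul_nonneg (by linarith) (by positivity))
      (le_classSize_residueColouring hl n)
  have hbern : (n : ℝ) ^ p * (1 - p * (l / n)) ≤ ((n : ℝ) - l) ^ p := by
    have h₁ : (n : ℝ) - l = n * (1 + -(l / n)) := by field_simp; ring
    have h₂ : (l : ℝ) / n ≤ 1 := by rw [div_le_one hn0]; exact hnl
    rw [h₁, mul_pow]
    refine mul_le_mul_of_nonneg_left ?_ (by positivity)
    have := one_add_mul_le_pow (a := -((l : ℝ) / n)) (by linarith) p
    linarith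
  have hpow : (n : ℝ) ^ 2 ≤ (n : ℝ) ^ p := pow_le_pow_right₀ hn1 hp
  have hfrac : U * (p * (l / n)) ≤ δ / 2 := by
    have : U * (p * ((l : ℝ) / n)) = U * p * l / n := by ring
    rw [this, div_le_iff₀ hn0]
    linarith
  have h₁ : (n : ℝ) ^ p * (1 - p * (l / n)) * U ≤ ((n : ℝ) - l) ^ p * U :=
    mul_le_mul_of_nonneg_right hbern hU0
  have h₂ : (n : ℝ) ^ p * (U * (p * (l / n))) ≤ (n : ℝ) ^ p * (δ / 2) :=
    mul_le_mul_of_nonneg_left hfrac (by positivity)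
  have h₃ : δ / 2 * (n : ℝ) ^ 2 ≤ δ / 2 * (n : ℝ) ^ p :=
    mul_le_mul_of_nonneg_left hpow (by positivity)
  calc _ ≤ (n : ℝ) ^ p * (U - δ) + δ / 2 * (n : ℝ) ^ p := add_le_add hsmall h₃
    _ = (n : ℝ) ^ p * U - (n : ℝ) ^ p * (δ / 2) := by ring
    _ ≤ (n : ℝ) ^ p * U - (n : ℝ) ^ p * (U * (p * (l / n))) := by linarith
    _ = (n : ℝ) ^ p * (1 - p * (l / n)) * U := by ring
    _ ≤ _ := h₁.trans hlarge

theorem exists_card_allowedKeys_gap (hl : 0 < l) (hr : ∀ k, 2 ≤ r k) (hrl : ∀ k, r k ≤ l)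
    (I : Set (Fin ρ)) (k : Fin ρ) :
    ∃ c : ℝ, 0 < c ∧ ∀ᶠ n : ℕ in atTop, ∀ γ : Fin n → Fin l, ¬ Balanced γ →
      ((allowedKeys r I γ k).card : ℝ) + c * (n : ℝ) ^ 2 ≤
        (allowedKeys r I (residueColouring hl n) k).card := by
  obtain ⟨c, hc, hgap⟩ := exists_elemSymm_classSize_gap (hr k) (hrl k) hl
  obtain ⟨d, hd, hcard⟩ := exists_card_allowedKeys (l := l) r I k
  have hd' : (0 : ℝ) < d := by exact_mod_cast hd
  have hf : (0 : ℝ) < (r k).factorial := by exact_mod_cast Nat.factorial_pos _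
  refine ⟨(r k).factorial * c / d, by positivity, ?_⟩
  filter_upwards [hgap] with n hn γ hγ
  have key : ∀ γ : Fin n → Fin l, ((allowedKeys r I γ k).card : ℝ) =
      (r k).factorial * (elemSymm (r k) Finset.univ fun i => (classSize γ i : ℝ)) / d := by
    intro γ
    rw [eq_div_iff hd'.ne', ← card_multichromaticTuples, hcard n γ, Nat.cast_mul]
  rw [key, key, div_mul_eq_mul_div, ← add_div]
  refine div_le_div_of_nonneg_right ?_ hd'.le
  rw [mul_assoc, ← mul_add]
  exact mul_le_mul_of_nonneg_left (hn γ hγ) hf.le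

theorem tendsto_pow_mul_pow_sq (a : ℝ) {q : ℝ} (ha : 0 ≤ a) (hq : 0 ≤ q) (hq1 : q < 1) :
    Tendsto (fun n : ℕ => a ^ n * (q ^ n) ^ n) atTop (𝓝 0) := by
  have h₁ : Tendsto (fun n : ℕ => a * q ^ n) atTop (𝓝 0) := by
    simpa using (tendsto_pow_atTop_nhds_zero_of_lt_one hq hq1).const_mul a
  have h₂ := tendsto_pow_atTop_nhds_zero_of_lt_one (by norm_num : (0 : ℝ) ≤ 1 / 2)
    (by norm_num : (1 / 2 : ℝ) < 1)
  refine squeeze_zero' (Eventually.of_forall fun n => by positivity) ?_ h₂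
  filter_upwards [h₁.eventually (eventually_le_nhds (by norm_num : (0 : ℝ) < 1 / 2))] with n hn
  rw [← mul_pow]
  exact pow_le_pow_left₀ (by positivity) hn n

/-- Unbalanced colourings are negligible: each of them colours fewer structures than the residue
colouring by a factor exponential in `n ^ 2`, and there are only `l ^ n` colourings. -/
theorem exists_unbalanced_bound (hl : 0 < l) (hρ : 0 < ρ) (hr : ∀ k, 2 ≤ r k)
    (hrl : ∀ k, r k ≤ l) (I : Set (Fin ρ)) :
    ∃ η : ℕ → ℝ, Tendsto η atTop (𝓝 0) ∧ ∀ᶠ n : ℕ in atTop,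
      ({M | ∃ γ : Fin n → Fin l, ¬ Balanced γ ∧ M ∈ colouredClass r I γ}.ncard : ℝ) ≤
        η n * (strongClass r l I n).ncard := by
  classical
  choose c hc hgap using exists_card_allowedKeys_gap hl hr hrl I
  have hcs : 0 < ∑ k, c k := Finset.sum_pos (fun k _ => hc k) ⟨⟨0, hρ⟩, Finset.mem_univ _⟩
  set q : ℝ := (2 : ℝ) ^ (-∑ k, c k) with hqdef
  have hq : 0 < q := by positivity
  have hq1 : q < 1 := Real.rpow_lt_one_of_one_lt_of_neg one_lt_two (neg_lt_zero.2 hcs)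
  refine ⟨fun n => (l : ℝ) ^ n * (q ^ n) ^ n,
    tendsto_pow_mul_pow_sq l (Nat.cast_nonneg _) hq.le hq1, ?_⟩
  filter_upwards [eventually_all.2 hgap] with n hn
  have hone : ∀ γ : Fin n → Fin l, ¬ Balanced γ →
      ((colouredClass r I γ).ncard : ℝ) ≤ (q ^ n) ^ n * (strongClass r l I n).ncard := by
    intro γ hγ
    have hsum : ((∑ k, (allowedKeys r I γ k).card : ℕ) : ℝ) + (∑ k, c k) * (n : ℝ) ^ 2 ≤
        ((∑ k, (allowedKeys r I (residueColouring hl n) k).card : ℕ) : ℝ) := by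
      rw [Nat.cast_sum, Nat.cast_sum, Finset.sum_mul, ← Finset.sum_add_distrib]
      exact Finset.sum_le_sum fun k _ => hn k γ hγ
    have hqn : (q ^ n) ^ n = (2 : ℝ) ^ (-((∑ k, c k) * (n : ℝ) ^ 2)) := by
      rw [hqdef, ← pow_mul, ← Real.rpow_natCast, ← Real.rpow_mul two_pos.le]
      congr 1
      push_cast
      ring
    calc ((colouredClass r I γ).ncard : ℝ)
        = (2 : ℝ) ^ ((∑ k, (allowedKeys r I γ k).card : ℕ) : ℝ) := by
          rw [ncard_colouredClass, Real.rpow_natCast, Nat.cast_pow, Nat.cast_ofNat]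
      _ ≤ (2 : ℝ) ^ (-((∑ k, c k) * (n : ℝ) ^ 2) +
            ((∑ k, (allowedKeys r I (residueColouring hl n) k).card : ℕ) : ℝ)) :=
          Real.rpow_le_rpow_of_exponent_le one_le_two (by linarith)
      _ = (q ^ n) ^ n * ((colouredClass r I (residueColouring hl n)).ncard : ℝ) := by
          rw [Real.rpow_add two_pos, hqn, ncard_colouredClass, Real.rpow_natCast, Nat.cast_pow,
            Nat.cast_ofNat]
      _ ≤ _ := by
          refine mul_le_mul_of_nonneg_left (Nat.cast_le.2 ?_) (by positivity)
          exact Set.ncard_le_ncard (fun M hM => mem_strongClass_iff.2 ⟨_, hM⟩) (Set.toFinite _)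
  set U : (Fin n → Fin l) → Set ((relLanguage r).Structure (Fin n)) :=
    fun γ => {M | ¬ Balanced γ ∧ M ∈ colouredClass r I γ} with hUdef
  have hU : {M | ∃ γ : Fin n → Fin l, ¬ Balanced γ ∧ M ∈ colouredClass r I γ} = ⋃ γ, U γ := by
    ext M
    simp [hUdef]
  rw [hU]
  calc ((⋃ γ, U γ).ncard : ℝ) ≤ ∑ γ, ((U γ).ncard : ℝ) := by
        exact_mod_cast Set.ncard_iUnion_le_of_fintype U
    _ ≤ ∑ _γ : Fin n → Fin l, (q ^ n) ^ n * ((strongClass r l I n).ncard : ℝ) := by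
        refine Finset.sum_le_sum fun γ _ => ?_
        by_cases hγ : Balanced γ
        · have : U γ = ∅ := Set.eq_empty_of_forall_notMem fun M hM => hM.1 hγ
          rw [this, Set.ncard_empty, Nat.cast_zero]
          positivity
        · refine le_trans (Nat.cast_le.2 ?_) (hone γ hγ)
          exact Set.ncard_le_ncard (fun M hM => hM.2) (Set.toFinite _)
    _ = _ := by
        rw [Finset.sum_const, Finset.card_univ, nsmul_eq_mul, Fintype.card_fun, Fintype.card_fin,
          Fintype.card_fin, Nat.cast_pow]
        ring

/-! ### Properties of almost all structures -/

section almostAll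

variable {L : FirstOrder.Language.{0, 0}} {K : (n : ℕ) → Set (L.Structure (Fin n))}
    {P Q : (n : ℕ) → L.Structure (Fin n) → Prop}

theorem almostAll_of_bound (hfin : ∀ n, (K n).Finite) (hne : ∀ n, (K n).Nonempty) {θ : ℕ → ℝ}
    (hθ : Tendsto θ atTop (𝓝 0))
    (h : ∀ᶠ n in atTop, ({M | M ∈ K n ∧ ¬ P n M}.ncard : ℝ) ≤ θ n * (K n).ncard) :
    AlmostAll K P := by
  have h₁ : Tendsto (fun n => 1 - θ n) atTop (𝓝 1) := by simpa using hθ.const_sub 1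
  refine tendsto_of_tendsto_of_tendsto_of_le_of_le' h₁ tendsto_const_nhds ?_ ?_
  · filter_upwards [h] with n hn
    have hpos : (0 : ℝ) < (K n).ncard := Nat.cast_pos.2 ((Set.ncard_pos (hfin n)).2 (hne n))
    have hle : (K n).ncard ≤
        {M | M ∈ K n ∧ P n M}.ncard + {M | M ∈ K n ∧ ¬ P n M}.ncard := by
      refine le_trans (Set.ncard_le_ncard (fun M hM => ?_) ?_) (Set.ncard_union_le _ _)
      · by_cases hP : P n M
        exacts [Or.inl ⟨hM, hP⟩, Or.inr ⟨hM, hP⟩]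
      · exact (hfin n).subset (Set.union_subset (fun M hM => hM.1) fun M hM => hM.1)
    have hle' : ((K n).ncard : ℝ) ≤
        {M | M ∈ K n ∧ P n M}.ncard + {M | M ∈ K n ∧ ¬ P n M}.ncard := by exact_mod_cast hle
    rw [le_div_iff₀ hpos]
    linarith
  · refine Eventually.of_forall fun n => div_le_one_of_le₀ (Nat.cast_le.2 ?_) (Nat.cast_nonneg _)
    exact Set.ncard_le_ncard (fun M hM => hM.1) (hfin n)

theorem almostAll_mono (hfin : ∀ n, (K n).Finite) (hP : AlmostAll K P)
    (h : ∀ n, ∀ M ∈ K n, P n M → Q n M) : AlmostAll K Q := by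
  refine tendsto_of_tendsto_of_tendsto_of_le_of_le hP tendsto_const_nhds (fun n => ?_) fun n => ?_
  · refine div_le_div_of_nonneg_right (Nat.cast_le.2 ?_) (Nat.cast_nonneg _)
    exact Set.ncard_le_ncard (fun M hM => ⟨hM.1, h n M hM.1 hM.2⟩)
      ((hfin n).subset fun M hM => hM.1)
  · refine div_le_one_of_le₀ (Nat.cast_le.2 ?_) (Nat.cast_nonneg _)
    exact Set.ncard_le_ncard (fun M hM => hM.1) (hfin n)

end almostAll

theorem strongClass_nonempty (hl : 0 < l) (n : ℕ) : (strongClass r l I n).Nonempty :=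
  ⟨ofRel fun _ _ => False, mem_strongClass_iff.2
    ⟨fun _ => ⟨0, hl⟩, fun _ _ h => h.elim, fun _ _ _ h => h.elim⟩⟩

/-- A structure with a colouring having enough extension properties has a bounded number of strong
colourings, since they all factor through that colouring. -/
theorem ncard_colourings_le {n : ℕ} {k : Fin ρ} (hr : 2 ≤ r k) (hrl : r k ≤ l)
    {M : (relLanguage r).Structure (Fin n)} {γ : Fin n → Fin l} (hγ : IsStrongColouring M γ)
    (h : ∀ m < l + 2, ExtensionProperty I M γ m) :
    {γ' : Fin n → Fin l | IsStrongColouring M γ'}.ncard ≤ l ^ l := by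
  classical
  have hsub : {γ' : Fin n → Fin l | IsStrongColouring M γ'} ⊆
      (fun f : Fin l → Fin l => f ∘ γ) '' Set.univ := by
    intro γ' hγ'
    have hfac : Function.FactorsThrough γ' γ := fun a b hab =>
      (colour_eq_iff hr hrl hγ (fun a b => sameColour_of_eq hr h) hγ' a b).2
        (sameColour_of_eq hr h hab)
    exact ⟨Function.extend γ γ' id, Set.mem_univ _, hfac.extend_comp _⟩
  calc _ ≤ _ := Set.ncard_le_ncard hsub (Set.toFinite _)
    _ ≤ (Set.univ : Set (Fin l → Fin l)).ncard := Set.ncard_image_le (Set.toFinite _)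
    _ = _ := by rw [Set.ncard_univ, Nat.card_eq_fintype_card]; simp

/-- Double counting of a relation in which each `a` has at most `N` partners. -/
theorem sum_ncard_le {α β : Type*} [Finite α] [Fintype β] (S : Set α) (R : β → α → Prop) (N : ℕ)
    (hS : ∀ b a, R b a → a ∈ S) (h : ∀ a, {b | R b a}.ncard ≤ N) :
    ∑ b, {a | R b a}.ncard ≤ N * S.ncard := by
  classical
  let _ : Fintype α := Fintype.ofFinite α
  have h₁ : ∀ b, {a | R b a}.ncard = (Finset.univ.filter fun a => R b a).card := fun b => by
    rw [← Set.ncard_coe_finset]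
    simp
  have h₂ : ∀ a, {b | R b a}.ncard = (Finset.univ.filter fun b => R b a).card := fun a => by
    rw [← Set.ncard_coe_finset]
    simp
  have h₃ : ∀ b, (Finset.univ.filter fun a => R b a) = S.toFinset.filter fun a => R b a := by
    intro b
    ext a
    simpa using hS b a
  calc ∑ b, {a | R b a}.ncard
      = ∑ b, (S.toFinset.filter fun a => R b a).card :=
        Finset.sum_congr rfl fun b _ => by rw [h₁, h₃]
    _ = ∑ a ∈ S.toFinset, (Finset.univ.filter fun b => R b a).card :=
        Finset.sum_card_bipartiteAbove_eq_sum_card_bipartiteBelow R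
    _ ≤ ∑ _a ∈ S.toFinset, N := Finset.sum_le_sum fun a _ => by
        rw [← h₂]
        exact h a
    _ = _ := by
        rw [Finset.sum_const, smul_eq_mul, mul_comm, Set.ncard_eq_toFinset_card']

/-- Almost all structures have a strong colouring with the extension properties. The balanced pairs
of a structure and a colouring are at most a bounded multiple of the structures, because most of
them have the extension properties and then the structure has few colourings. So the exceptional
pairs are negligible even in comparison with the structures. -/
theorem almostAll_extensionProperties (hl : 0 < l) (hρ : 0 < ρ) (hr : ∀ k, 2 ≤ r k)
    (hrl : ∀ k, r k ≤ l) (I : Set (Fin ρ)) (K : ℕ) :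
    AlmostAll (strongClass r l I) fun n M =>
      ∃ γ : Fin n → Fin l, M ∈ colouredClass r I γ ∧ ∀ m < K, ExtensionProperty I M γ m := by
  classical
  -- The bound on the number of colourings needs the extension properties for fewer than `l + 2`
  -- points.
  wlog hK : l + 2 ≤ K generalizing K
  · refine almostAll_mono (fun n => Set.toFinite _) (this (max K (l + 2)) (le_max_right _ _)) ?_
    rintro n M - ⟨γ, hM, h⟩
    exact ⟨γ, hM, fun m hm => h m (lt_max_of_lt_left hm)⟩
  obtain ⟨ε, hε, hbal⟩ := exists_extensionProperties_bound hl r I K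
  obtain ⟨η, hη, hunbal⟩ := exists_unbalanced_bound hl hρ hr hrl I
  have hlim : Tendsto (fun n => η n + |ε n| * (2 * (l : ℝ) ^ l)) atTop (𝓝 0) := by
    simpa using hη.add (hε.abs.mul_const (2 * (l : ℝ) ^ l))
  refine almostAll_of_bound (fun n => Set.toFinite _) (strongClass_nonempty hl) hlim ?_
  filter_upwards [hunbal, hε.eventually (eventually_le_nhds (by norm_num : (0 : ℝ) < 1 / 2))]
    with n hn hεn
  set S : ℝ := ((strongClass r l I n).ncard : ℝ) with hS
  set good : (Fin n → Fin l) → (relLanguage r).Structure (Fin n) → Prop := fun γ M =>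
    Balanced γ ∧ M ∈ colouredClass r I γ ∧ ∀ m < K, ExtensionProperty I M γ m with hgood
  set bad : (Fin n → Fin l) → (relLanguage r).Structure (Fin n) → Prop := fun γ M =>
    Balanced γ ∧ M ∈ colouredClass r I γ ∧ ¬ ∀ m < K, ExtensionProperty I M γ m with hbad
  set all : (Fin n → Fin l) → (relLanguage r).Structure (Fin n) → Prop := fun γ M =>
    Balanced γ ∧ M ∈ colouredClass r I γ with hall
  have hgoodS : ∑ γ, ({M | good γ M}.ncard : ℝ) ≤ (l : ℝ) ^ l * S := by
    have := sum_ncard_le (strongClass r l I n) good (l ^ l)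
      (fun γ M h => mem_strongClass_iff.2 ⟨γ, h.2.1⟩) fun M => by
        rcases Set.eq_empty_or_nonempty {γ | good γ M} with he | ⟨γ, hγ⟩
        · rw [he, Set.ncard_empty]
          exact Nat.zero_le _
        · refine le_trans (Set.ncard_le_ncard (fun γ' hγ' => ?_) (Set.toFinite _))
            (ncard_colourings_le (hr ⟨0, hρ⟩) (hrl _) hγ.2.1.1
              fun m hm => hγ.2.2 m (lt_of_lt_of_le hm hK))
          exact hγ'.2.1.1
    rw [hS]
    exact_mod_cast this
  have hbadall : ∑ γ, ({M | bad γ M}.ncard : ℝ) ≤ ε n * ∑ γ, ({M | all γ M}.ncard : ℝ) := by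
    rw [Finset.mul_sum]
    refine Finset.sum_le_sum fun γ _ => ?_
    by_cases hγ : Balanced γ
    · simpa [hbad, hall, hγ] using hbal n γ hγ
    · simp [hbad, hall, hγ]
  have hsplit : ∑ γ, ({M | all γ M}.ncard : ℝ) ≤
      ∑ γ, ({M | good γ M}.ncard : ℝ) + ∑ γ, ({M | bad γ M}.ncard : ℝ) := by
    rw [← Finset.sum_add_distrib]
    refine Finset.sum_le_sum fun γ _ => ?_
    rw [← Nat.cast_add]
    refine Nat.cast_le.2 ((Set.ncard_le_ncard (fun M hM => ?_) (Set.toFinite _)).trans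
      (Set.ncard_union_le _ _))
    by_cases h : ∀ m < K, ExtensionProperty I M γ m
    exacts [Or.inl ⟨hM.1, hM.2, h⟩, Or.inr ⟨hM.1, hM.2, h⟩]
  have hall0 : 0 ≤ ∑ γ, ({M | all γ M}.ncard : ℝ) :=
    Finset.sum_nonneg fun _ _ => Nat.cast_nonneg _
  have hall2 : ∑ γ, ({M | all γ M}.ncard : ℝ) ≤ 2 * (l : ℝ) ^ l * S := by
    have := mul_le_mul_of_nonneg_right hεn hall0
    linarith
  have hcover : ({M | M ∈ strongClass r l I n ∧ ¬ ∃ γ : Fin n → Fin l, M ∈ colouredClass r I γ ∧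
      ∀ m < K, ExtensionProperty I M γ m}.ncard : ℝ) ≤
      ({M | ∃ γ : Fin n → Fin l, ¬ Balanced γ ∧ M ∈ colouredClass r I γ}.ncard : ℝ) +
        ∑ γ, ({M | bad γ M}.ncard : ℝ) := by
    have hsub : {M | M ∈ strongClass r l I n ∧ ¬ ∃ γ : Fin n → Fin l, M ∈ colouredClass r I γ ∧
        ∀ m < K, ExtensionProperty I M γ m} ⊆
        {M | ∃ γ : Fin n → Fin l, ¬ Balanced γ ∧ M ∈ colouredClass r I γ} ∪
          ⋃ γ, {M | bad γ M} := by
      rintro M ⟨hM, hno⟩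
      obtain ⟨γ, hγ⟩ := mem_strongClass_iff.1 hM
      by_cases hb : Balanced γ
      · exact Or.inr (Set.mem_iUnion.2 ⟨γ, hb, hγ, fun h => hno ⟨γ, hγ, h⟩⟩)
      · exact Or.inl ⟨γ, hb, hγ⟩
    have := (Set.ncard_le_ncard hsub (Set.toFinite _)).trans ((Set.ncard_union_le _ _).trans
      (Nat.add_le_add_left (Set.ncard_iUnion_le_of_fintype fun γ => {M | bad γ M}) _))
    exact_mod_cast this
  have hfin : ε n * ∑ γ, ({M | all γ M}.ncard : ℝ) ≤ |ε n| * (2 * (l : ℝ) ^ l * S) :=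
    (mul_le_mul_of_nonneg_right (le_abs_self _) hall0).trans
      (mul_le_mul_of_nonneg_left hall2 (abs_nonneg _))
  calc _ ≤ _ := hcover
    _ ≤ η n * S + |ε n| * (2 * (l : ℝ) ^ l * S) := add_le_add hn (hbadall.trans hfin)
    _ = _ := by ring

end StrongColouring

theorem mainTheorem2 (l : ℕ) (hl : 2 ≤ l) (ρ : ℕ) (hρ : 0 < ρ) (r : Fin ρ → ℕ)
    (hr : ∀ k, 2 ≤ r k) (hrl : ∀ k, r k ≤ l) (I : Set (Fin ρ)) :
    (∃ ξ : (relLanguage r).Formula (Fin 2),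
      AlmostAll (strongClass r l I) (fun n M =>
        ∀ γ : Fin n → Fin l, IsStrongColouring M γ →
          ∀ a b : Fin n, γ a = γ b ↔ FormulaTrue M ξ a b)) ∧
    AlmostAll (strongClass r l I) (fun _ M => UniquelyStronglyColourable l M) ∧
    HasZeroOneLaw (strongClass r l I) := by
  have hl0 : 0 < l := by omega
  have hfin : ∀ n, (strongClass r l I n).Finite := fun n => Set.toFinite _
  have hext := StrongColouring.almostAll_extensionProperties hl0 hρ hr hrl I
  set k : Fin ρ := ⟨0, hρ⟩
  have hdef : ∀ (n : ℕ) (M : (relLanguage r).Structure (Fin n)),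
      (∃ γ : Fin n → Fin l, M ∈ StrongColouring.colouredClass r I γ ∧
        ∀ m < l + 2, StrongColouring.ExtensionProperty I M γ m) →
      ∀ γ : Fin n → Fin l, IsStrongColouring M γ → ∀ a b : Fin n,
        γ a = γ b ↔ FormulaTrue M (StrongColouring.sameColour l k) a b := by
    rintro n M ⟨γ, hM, h⟩ γ' hγ'
    exact StrongColouring.colour_eq_iff (hr k) (hrl k) hM.1
      (fun a b => StrongColouring.sameColour_of_eq (hr k) h) hγ'
  refine ⟨⟨StrongColouring.sameColour l k, ?_⟩, ?_, fun φ => ?_⟩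
  · exact StrongColouring.almostAll_mono hfin (hext (l + 2)) fun n M _ h => hdef n M h
  · refine StrongColouring.almostAll_mono hfin (hext (l + 2)) fun n M hM h => ⟨hM.1, ?_⟩
    intro γ γ' hγ hγ' a b
    rw [hdef n M h γ hγ, hdef n M h γ' hγ']
  · -- All structures with the extension properties agree on `φ`, so one of them decides.
    obtain ⟨K, hK⟩ := StrongColouring.exists_sentenceTrue_iff hr l I φ
    by_cases hex : ∃ (n : ℕ) (M : (relLanguage r).Structure (Fin n)), SentenceTrue M φ ∧
        ∃ γ : Fin n → Fin l, M ∈ StrongColouring.colouredClass r I γ ∧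
          ∀ m < K, StrongColouring.ExtensionProperty I M γ m
    · obtain ⟨n₀, N, hφ, δ, hN, hNext⟩ := hex
      refine Or.inl (StrongColouring.almostAll_mono hfin (hext K) ?_)
      rintro n M - ⟨γ, hM, hMext⟩
      exact (hK _ _ M N γ δ hM hN hMext hNext).2 hφ
    · refine Or.inr (StrongColouring.almostAll_mono hfin (hext K) fun n M _ h => ?_)
      exact fun hφ => hex ⟨n, M, hφ, h⟩
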